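/- Let $N\ge 1$ be an integer and $\Gamma_0(N)=\left\{\begin{pmatrix}a&b\\c&d\end{pmatrix}\in SL_2(\mathbb Z): c\equiv 0 \pmod N\right\}$. For $\gamma=\begin{pmatrix}a&b\\c&d\end{pmatrix}$ put $\mu_\gamma(z,w)=czw+dw+az+b$. Let $z_1,z_2$ be points of the open upper half-plane such that $z_2\neq\gamma z_1$ for all $\gamma\in\Gamma_0(N)$. Then the series $$\Xi_N(z_1,z_2,s)=\frac12\sum_{\gamma\in\Gamma_0(N)}\frac{\overline{\mu_\gamma(z_1,-z_2)}\;\overline{\mu_\gamma(z_1,-\overline{z_2})}}{|\mu_\gamma(z_1,-z_2)|^{2s}\,|\mu_\gamma(z_1,-\overline{z_2})|^{2s}}$$ converges absolutely for every $s\in\mathbb C$ with $\operatorname{Re}(s)>1$, and, as a function of $s$, it can be analytically continued to the point $s=1$ (without a pole there): there are a connected open set $U\subseteq\mathbb C$ containing both the half-plane $\{\operatorname{Re}(s)>1\}$ and the point $1$, and a holomorphic function $F$ on $U$, with $F(s)=\Xi_N(z_1,z_2,s)$ whenever $\operatorname{Re}(s)>1$. -/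

import Mathlib

open scoped MatrixGroups UpperHalfPlane ComplexConjugate

noncomputable section

/-- `μ_γ(z, w) = c z w + d w + a z + b` for `γ = (a b; c d)`. -/
def mu (γ : SL(2, ℤ)) (z w : ℂ) : ℂ :=
  (γ 1 0 : ℂ) * z * w + (γ 1 1 : ℂ) * w + (γ 0 0 : ℂ) * z + (γ 0 1 : ℂ)

/-- The summand attached to `γ` in the Hecke-regularized Cauchy kernel:
the product of the conjugates of `μ_γ(z₁, -z₂)` and `μ_γ(z₁, -conj z₂)`, divided by
`|μ_γ(z₁, -z₂)| ^ (2 s) * |μ_γ(z₁, -conj z₂)| ^ (2 s)`. -/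
def cauchyTerm (γ : SL(2, ℤ)) (z₁ z₂ s : ℂ) : ℂ :=
  (conj (mu γ z₁ (-z₂)) * conj (mu γ z₁ (-conj z₂))) /
    ((‖mu γ z₁ (-z₂)‖ : ℂ) ^ (2 * s) * (‖mu γ z₁ (-conj z₂)‖ : ℂ) ^ (2 * s))

/-- The series `Ξ_N(z₁, z₂, s)`, a sum over all of `Γ₀(N)`. -/
def cauchyKernel (N : ℕ) (z₁ z₂ s : ℂ) : ℂ :=
  (1 / 2) * ∑' γ : CongruenceSubgroup.Gamma0 N, cauchyTerm (γ : SL(2, ℤ)) z₁ z₂ s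

end

/-!
Off the upper triangular matrices, the summand of `γ = (a b; c d)` is close to
`|c| ^ (2 - 4 s) A(a / c) D(d / c)`, where `A` and `D` are smooth decaying functions depending on
`s`; the differences, and the upper triangular summands, still have a locally uniformly convergent
sum to the left of `Re s = 1`. For fixed `c`, the sum of `A(a / c) D(d / c)` runs over the pairs
with `a d ≡ 1` modulo `c`, and Poisson summation expands it into Kloosterman sums modulo `c`. The
zero frequency contributes `φ(c) ∫ A ∫ D`, and every other one is small by Kloosterman's bound
`K(m, n; c) = O(|m| ^ (1 / 4) d(c) c ^ (11 / 12))`, which the fourth moment of `K` gives by counting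
the solutions of `x + y = z + w`, `x⁻¹ + y⁻¹ = z⁻¹ + w⁻¹` modulo `c`. The sum of
`φ(c) c ^ (2 - 4 s)` over the multiples of `N` has a simple pole at `s = 1`, which is cancelled by
the zero of `∫ D` there: at `s = 1` the function `D` is the derivative of `-(x + z₁)⁻¹`.
-/

/-! ### Kloosterman sums -/

section Kloosterman

open Finset

/-- The Kloosterman sum `K(m, n; c) = ∑ e((m u + n u⁻¹) / c)`, over the units `u` modulo `c`. -/
noncomputable def kloostermanSum (c : ℕ) [NeZero c] (m n : ZMod c) : ℂ :=
  ∑ u : (ZMod c)ˣ, ZMod.stdAddChar (m * (u : ZMod c) + n * ((u⁻¹ : (ZMod c)ˣ) : ZMod c))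

lemma mul_sub_sub_add_eq_zero_of_inv_add_inv_eq {R : Type*} [CommRing R] {x y z w : Rˣ}
    (hadd : (x + y : R) = z + w)
    (hinv : ((x⁻¹ : Rˣ) + (y⁻¹ : Rˣ) : R) = (z⁻¹ : Rˣ) + (w⁻¹ : Rˣ)) :
    (x - w : R) * (y - w) * (x + y) = 0 := by
  have hxy : (x * y : R) * ((x⁻¹ : Rˣ) + (y⁻¹ : Rˣ)) = x + y := by
    linear_combination (y : R) * x.mul_inv + x * y.mul_inv
  have hzw : (z * w : R) * ((z⁻¹ : Rˣ) + (w⁻¹ : Rˣ)) = z + w := by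
    linear_combination (w : R) * z.mul_inv + z * w.mul_inv
  have hprod : (z + w : R) * (x * y - z * w) = 0 := by
    linear_combination (z * w : R) * hxy - x * y * hzw + z * w * hadd - x * y * z * w * hinv
  have hz : (z : R) = x + y - w := by linear_combination -hadd
  rw [hz] at hprod
  linear_combination hprod

variable {c : ℕ} [NeZero c]

lemma kloostermanSum_comm (m n : ZMod c) : kloostermanSum c m n = kloostermanSum c n m :=
  Fintype.sum_equiv (Equiv.inv _) _ _ fun u => by simp [add_comm]

lemma kloostermanSum_mul_unit (m n : ZMod c) (v : (ZMod c)ˣ) :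
    kloostermanSum c (m * v) (n * (v⁻¹ : (ZMod c)ˣ)) = kloostermanSum c m n :=
  Fintype.sum_equiv (Equiv.mulLeft v) _ _ fun u => by
    simp only [Equiv.coe_mulLeft, mul_inv_rev, Units.val_mul]
    ring_nf

lemma kloostermanSum_zero_zero : kloostermanSum c 0 0 = c.totient := by
  simp [kloostermanSum, ZMod.card_units_eq_totient]

lemma sum_stdAddChar_mul (x : ZMod c) :
    ∑ m : ZMod c, ZMod.stdAddChar (m * x) = if x = 0 then (c : ℂ) else 0 := by
  rw [AddChar.sum_mulShift x (ZMod.isPrimitive_stdAddChar c), ZMod.card]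
  split_ifs <;> simp

lemma norm_sq_sum_stdAddChar {ι : Type*} [Fintype ι] (a : ι → ZMod c) :
    ((‖∑ i, (ZMod.stdAddChar (a i) : ℂ)‖ ^ 2 : ℝ) : ℂ) =
      ∑ p : ι × ι, ZMod.stdAddChar (a p.1 - a p.2) := by
  rw [Complex.ofReal_pow, ← Complex.mul_conj', map_sum, sum_mul_sum, Fintype.sum_prod_type]
  refine sum_congr rfl fun i _ => sum_congr rfl fun j _ => ?_
  rw [← AddChar.map_neg_eq_conj, ← AddChar.map_add_eq_mul, sub_eq_add_neg]

lemma sum_norm_sq_charSum {ι : Type*} [Fintype ι] (a b : ι → ZMod c) :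
    ∑ m : ZMod c, ∑ n : ZMod c, ‖∑ i, (ZMod.stdAddChar (m * a i + n * b i) : ℂ)‖ ^ 2 =
      (c : ℝ) ^ 2 * #{p : ι × ι | a p.1 = a p.2 ∧ b p.1 = b p.2} := by
  have hpair (p : ι × ι) : ∑ m : ZMod c, ∑ n : ZMod c,
      ZMod.stdAddChar (m * a p.1 + n * b p.1 - (m * a p.2 + n * b p.2)) =
        if a p.1 = a p.2 ∧ b p.1 = b p.2 then (c : ℂ) ^ 2 else 0 := by
    calc _ = (∑ m : ZMod c, ZMod.stdAddChar (m * (a p.1 - a p.2))) *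
          ∑ n : ZMod c, ZMod.stdAddChar (n * (b p.1 - b p.2)) := by
          rw [sum_mul_sum]
          refine sum_congr rfl fun m _ => sum_congr rfl fun n _ => ?_
          rw [← AddChar.map_add_eq_mul]
          ring_nf
      _ = _ := by
          simp only [sum_stdAddChar_mul, sub_eq_zero, ite_zero_mul_ite_zero, sq]
  apply Complex.ofReal_injective
  simp_rw [Complex.ofReal_sum, norm_sq_sum_stdAddChar]
  rw [sum_congr rfl fun m _ => sum_comm, sum_comm]
  simp_rw [hpair, ← sum_filter, sum_const, nsmul_eq_mul]
  push_cast
  ring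

lemma card_le_gcd_val_le {x : ℝ} (hx : 0 < x) :
    (#{p : ZMod c | x ≤ (p.val.gcd c : ℝ)} : ℝ) ≤ #c.divisors * (c / x) := by
  have hsub : ({p : ZMod c | x ≤ (p.val.gcd c : ℝ)} : Finset (ZMod c)) ⊆
      (c.divisors.filter fun e : ℕ => x ≤ e).biUnion fun e => {p : ZMod c | (c / e) • p = 0} := by
    intro p hp
    simp only [mem_filter, mem_univ, true_and, mem_biUnion, Nat.mem_divisors] at hp ⊢
    refine ⟨_, ⟨⟨Nat.gcd_dvd_right _ _, NeZero.ne c⟩, hp⟩, ?_⟩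
    rw [nsmul_eq_mul, ← ZMod.natCast_zmod_val p, ← Nat.cast_mul, ZMod.natCast_eq_zero_iff,
      ZMod.natCast_zmod_val, Nat.div_mul_right_comm (Nat.gcd_dvd_right _ _),
      Nat.mul_div_assoc _ (Nat.gcd_dvd_left _ _)]
    exact dvd_mul_right _ _
  have hfibre {e : ℕ} (he : e ∈ c.divisors.filter fun e : ℕ => x ≤ e) :
      (#{p : ZMod c | (c / e) • p = 0} : ℝ) ≤ c / x := by
    obtain ⟨hdvd, hxe⟩ := mem_filter.1 he
    have hpos : 0 < c / e := Nat.div_pos (Nat.divisor_le hdvd) (Nat.pos_of_mem_divisors hdvd)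
    calc (#{p : ZMod c | (c / e) • p = 0} : ℝ) ≤ (c / e : ℕ) := by
          exact Nat.cast_le.2 (IsAddCyclic.card_nsmul_eq_zero_le hpos)
      _ ≤ c / e := Nat.cast_div_le
      _ ≤ c / x := by gcongr
  calc (#{p : ZMod c | x ≤ (p.val.gcd c : ℝ)} : ℝ)
      ≤ ∑ e ∈ c.divisors.filter fun e : ℕ => x ≤ e, (#{p : ZMod c | (c / e) • p = 0} : ℝ) := by
        exact_mod_cast (card_le_card hsub).trans card_biUnion_le
    _ ≤ ∑ _e ∈ c.divisors.filter fun e : ℕ => x ≤ e, (c / x : ℝ) := sum_le_sum fun _ he => hfibre he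
    _ ≤ #c.divisors * (c / x) := by
        rw [sum_const, nsmul_eq_mul]
        gcongr
        exact filter_subset _ _

lemma rpow_le_gcd_val_of_mul_mul_eq_zero {p q r : ZMod c} (h : p * q * r = 0) :
    (c : ℝ) ^ (1 / 3 : ℝ) ≤ p.val.gcd c ∨ (c : ℝ) ^ (1 / 3 : ℝ) ≤ q.val.gcd c ∨
      (c : ℝ) ^ (1 / 3 : ℝ) ≤ r.val.gcd c := by
  have hdvd : c ∣ p.val * q.val * r.val := by
    rw [← ZMod.natCast_eq_zero_iff]
    simpa using h
  have hle : c ≤ p.val.gcd c * q.val.gcd c * r.val.gcd c := by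
    refine Nat.le_of_dvd (by positivity [NeZero.pos c]) ?_
    simp only [Nat.gcd_comm _ c]
    exact (Nat.dvd_gcd dvd_rfl hdvd).trans ((Nat.gcd_mul_right_dvd_mul_gcd c _ _).trans
      (Nat.mul_dvd_mul_right (Nat.gcd_mul_right_dvd_mul_gcd c _ _) _))
  by_contra! hlt
  refine hle.not_gt ((Nat.cast_lt (α := ℝ)).1 ?_)
  calc ((p.val.gcd c * q.val.gcd c * r.val.gcd c : ℕ) : ℝ)
      = p.val.gcd c * q.val.gcd c * r.val.gcd c := by push_cast; rfl
    _ < (c : ℝ) ^ (1 / 3 : ℝ) * (c : ℝ) ^ (1 / 3 : ℝ) * (c : ℝ) ^ (1 / 3 : ℝ) := by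
        gcongr
        exacts [hlt.1, hlt.2.1, hlt.2.2]
    _ = c := by
        rw [← pow_two, ← pow_succ, ← Real.rpow_natCast, ← Real.rpow_mul (Nat.cast_nonneg c)]
        norm_num

lemma card_sub_mul_sub_mul_add_eq_zero_le (a b : ZMod c) :
    (#{p : ZMod c × ZMod c | (p.1 - a) * (p.2 - b) * (p.1 + p.2) = 0} : ℝ) ≤
      3 * #c.divisors * (c : ℝ) ^ (5 / 3 : ℝ) := by
  have hc : (0 : ℝ) < c := by exact_mod_cast NeZero.pos c
  set A : Finset (ZMod c) := {p | (c : ℝ) ^ (1 / 3 : ℝ) ≤ (p.val.gcd c : ℝ)} with hA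
  have hfibre {g : ZMod c × ZMod c → ZMod c × ZMod c} (hg : g.Injective) :
      #{p | (g p).1 ∈ A} ≤ #A * c := by
    calc #{p | (g p).1 ∈ A} ≤ #(A ×ˢ (univ : Finset (ZMod c))) :=
          card_le_card_of_injOn g (by intro p; simp) hg.injOn
      _ = #A * c := by rw [card_product, card_univ, ZMod.card]
  have hsub : ({p : ZMod c × ZMod c | (p.1 - a) * (p.2 - b) * (p.1 + p.2) = 0} : Finset _) ⊆
      ({p : ZMod c × ZMod c | p.1 - a ∈ A} : Finset _) ∪ ({p | p.2 - b ∈ A} : Finset _) ∪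
        ({p | p.1 + p.2 ∈ A} : Finset _) := by
    intro p hp
    simp only [hA, mem_filter, mem_univ, true_and, mem_union, or_assoc] at hp ⊢
    exact rpow_le_gcd_val_of_mul_mul_eq_zero hp
  have hcard : #{p : ZMod c × ZMod c | (p.1 - a) * (p.2 - b) * (p.1 + p.2) = 0} ≤
      #A * c + #A * c + #A * c := by
    refine (card_le_card hsub).trans ((card_union_le _ _).trans
      (add_le_add ((card_union_le _ _).trans (add_le_add ?_ ?_)) ?_))
    · exact hfibre (g := fun p => (p.1 - a, p.2)) fun p q h => by aesop
    · exact hfibre (g := fun p => (p.2 - b, p.1)) fun p q h => by aesop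
    · exact hfibre (g := fun p => (p.1 + p.2, p.2)) fun p q h => by aesop
  have hexp : (c : ℝ) / (c : ℝ) ^ (1 / 3 : ℝ) * c = (c : ℝ) ^ (5 / 3 : ℝ) := by
    rw [div_mul_eq_mul_div, ← sq, ← Real.rpow_natCast, ← Real.rpow_sub hc]
    norm_num
  calc (#{p : ZMod c × ZMod c | (p.1 - a) * (p.2 - b) * (p.1 + p.2) = 0} : ℝ)
      ≤ 3 * #A * c := by
        have : (_ : ℝ) ≤ (#A * c + #A * c + #A * c : ℕ) := Nat.cast_le.2 hcard
        push_cast at this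
        linarith
    _ ≤ 3 * (#c.divisors * (c / (c : ℝ) ^ (1 / 3 : ℝ))) * c := by
        gcongr
        exact card_le_gcd_val_le (by positivity)
    _ = 3 * #c.divisors * (c : ℝ) ^ (5 / 3 : ℝ) := by rw [← hexp]; ring

lemma card_units_add_eq_add_le :
    (#{p : ((ZMod c)ˣ × (ZMod c)ˣ) × ((ZMod c)ˣ × (ZMod c)ˣ) |
      (p.1.1 + p.1.2 : ZMod c) = p.2.1 + p.2.2 ∧
      ((p.1.1⁻¹ : (ZMod c)ˣ) + (p.1.2⁻¹ : (ZMod c)ˣ) : ZMod c) =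
        (p.2.1⁻¹ : (ZMod c)ˣ) + (p.2.2⁻¹ : (ZMod c)ˣ)} : ℝ) ≤
    c.totient * (3 * #c.divisors * (c : ℝ) ^ (5 / 3 : ℝ)) := by
  rw [← ZMod.card_units_eq_totient, ← card_univ, ← nsmul_eq_mul,
    card_eq_sum_card_fiberwise (f := fun p => p.2.2) (t := univ) (by simp), Nat.cast_sum]
  refine sum_le_card_nsmul _ _ _ fun w _ => le_trans (Nat.cast_le.2 ?_)
    (card_sub_mul_sub_mul_add_eq_zero_le (w : ZMod c) w)
  refine card_le_card_of_injOn (fun p => ((p.1.1 : ZMod c), (p.1.2 : ZMod c))) ?_ ?_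
  · rintro ⟨⟨x, y⟩, z, w⟩ hp
    simp only [coe_filter, mem_filter, mem_univ, true_and, Set.mem_ofPred_eq] at hp ⊢
    obtain ⟨⟨hadd, hinv⟩, rfl⟩ := hp
    simpa using mul_sub_sub_add_eq_zero_of_inv_add_inv_eq hadd hinv
  · rintro ⟨⟨x, y⟩, z, w⟩ hp ⟨⟨x', y'⟩, z', w'⟩ hp' h
    simp only [coe_filter, mem_filter, mem_univ, true_and, Set.mem_ofPred_eq, Prod.mk.injEq,
      Units.val_inj] at hp hp' h
    obtain ⟨⟨hadd, -⟩, rfl⟩ := hp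
    obtain ⟨⟨hadd', -⟩, rfl⟩ := hp'
    obtain ⟨rfl, rfl⟩ := h
    have : z = z' := Units.ext (add_right_cancel (hadd.symm.trans hadd'))
    rw [this]

lemma sum_norm_kloostermanSum_pow_four_le :
    ∑ m : ZMod c, ∑ n : ZMod c, ‖kloostermanSum c m n‖ ^ 4 ≤
      (c : ℝ) ^ 2 * (c.totient * (3 * #c.divisors * (c : ℝ) ^ (5 / 3 : ℝ))) := by
  have hsq (m n : ZMod c) : ‖kloostermanSum c m n‖ ^ 4 =
      ‖∑ i : (ZMod c)ˣ × (ZMod c)ˣ, (ZMod.stdAddChar (m * (i.1 + i.2 : ZMod c) +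
        n * ((i.1⁻¹ : (ZMod c)ˣ) + (i.2⁻¹ : (ZMod c)ˣ) : ZMod c)) : ℂ)‖ ^ 2 := by
    rw [show (4 : ℕ) = 2 * 2 from rfl, pow_mul, ← norm_pow, sq (kloostermanSum c m n),
      kloostermanSum, sum_mul_sum, Fintype.sum_prod_type]
    congr 2
    refine sum_congr rfl fun i _ => sum_congr rfl fun j _ => ?_
    rw [← AddChar.map_add_eq_mul]
    ring_nf
  simp_rw [hsq]
  rw [sum_norm_sq_charSum]
  gcongr
  exact card_units_add_eq_add_le

lemma card_intCast_mul_eq_le {m : ℤ} (hm : m ≠ 0) (v : ZMod c) :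
    #{u : ZMod c | (m : ZMod c) * u = v} ≤ m.natAbs := by
  rcases eq_empty_or_nonempty ({u : ZMod c | (m : ZMod c) * u = v} : Finset _) with h | ⟨u, hu⟩
  · simp [h]
  have hfibre := AddMonoidHom.card_fiber_eq_of_mem_range (AddMonoidHom.mulLeft (m : ZMod c))
    (x := v) (y := 0) ⟨u, (mem_filter.1 hu).2⟩ ⟨0, mul_zero _⟩
  have hsmul (u : ZMod c) : (m : ZMod c) * u = 0 ↔ m.natAbs • u = 0 := by
    rw [← zsmul_eq_mul, ← natCast_zsmul, Int.natCast_natAbs]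
    rcases abs_choice m with h | h <;> simp [h]
  simp only [AddMonoidHom.coe_mulLeft, hsmul] at hfibre
  exact hfibre.trans_le (IsAddCyclic.card_nsmul_eq_zero_le (Int.natAbs_pos.2 hm))

-- `K(m, n; c) = K(m v, n v⁻¹; c)` takes the same value on the whole orbit of `(m, n)` under the
-- units `v`, which visits each pair at most `|m|` times.
lemma totient_mul_norm_kloostermanSum_pow_four_le {m : ℤ} (hm : m ≠ 0) (n : ZMod c) :
    c.totient * ‖kloostermanSum c m n‖ ^ 4 ≤
      |(m : ℝ)| * ∑ k : ZMod c, ∑ l : ZMod c, ‖kloostermanSum c k l‖ ^ 4 := by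
  classical
  have hfibre (k : ZMod c) : (#{v : (ZMod c)ˣ | (m : ZMod c) * v = k} : ℝ) ≤ |(m : ℝ)| := by
    rw [← Int.cast_abs, Int.abs_eq_natAbs]
    exact_mod_cast (card_le_card_of_injOn (fun v : (ZMod c)ˣ => (v : ZMod c))
      (by intro; simp) Units.val_injective.injOn).trans (card_intCast_mul_eq_le hm k)
  calc c.totient * ‖kloostermanSum c m n‖ ^ 4
      = ∑ v : (ZMod c)ˣ, ‖kloostermanSum c (m * v) (n * (v⁻¹ : (ZMod c)ˣ))‖ ^ 4 := by
        simp [kloostermanSum_mul_unit, ZMod.card_units_eq_totient]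
    _ ≤ ∑ v : (ZMod c)ˣ, ∑ l : ZMod c, ‖kloostermanSum c (m * v) l‖ ^ 4 := by
        gcongr with v
        exact single_le_sum (f := fun l => ‖kloostermanSum c (m * v) l‖ ^ 4)
          (fun l _ => by positivity) (mem_univ _)
    _ = ∑ k : ZMod c, #{v : (ZMod c)ˣ | (m : ZMod c) * v = k} *
          ∑ l : ZMod c, ‖kloostermanSum c k l‖ ^ 4 := by
        rw [← sum_fiberwise' univ (fun v : (ZMod c)ˣ => (m : ZMod c) * v)
          (fun k => ∑ l : ZMod c, ‖kloostermanSum c k l‖ ^ 4)]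
        simp
    _ ≤ |(m : ℝ)| * ∑ k : ZMod c, ∑ l : ZMod c, ‖kloostermanSum c k l‖ ^ 4 := by
        rw [mul_sum]
        gcongr with k
        exact hfibre k

lemma norm_kloostermanSum_le_of_left_ne_zero {m : ℤ} (hm : m ≠ 0) (n : ZMod c) :
    ‖kloostermanSum c m n‖ ≤ 3 * |(m : ℝ)| ^ (1 / 4 : ℝ) *
      (#c.divisors * (c : ℝ) ^ (11 / 12 : ℝ)) := by
  have hc : (0 : ℝ) < c := by exact_mod_cast NeZero.pos c
  have hφ : (0 : ℝ) < c.totient := by exact_mod_cast Nat.totient_pos.2 (NeZero.pos c)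
  have hd : (1 : ℝ) ≤ #c.divisors := by
    exact_mod_cast card_pos.2 ⟨1, Nat.one_mem_divisors.2 (NeZero.ne c)⟩
  have hroot : (|(m : ℝ)| ^ (1 / 4 : ℝ)) ^ 4 = |(m : ℝ)| := by
    rw [← Real.rpow_natCast, ← Real.rpow_mul (abs_nonneg _)]; norm_num
  have hexp : ((c : ℝ) ^ (11 / 12 : ℝ)) ^ 4 = (c : ℝ) ^ 2 * (c : ℝ) ^ (5 / 3 : ℝ) := by
    rw [← Real.rpow_natCast, ← Real.rpow_natCast, ← Real.rpow_mul hc.le, ← Real.rpow_add hc]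
    norm_num
  have hfour : ‖kloostermanSum c m n‖ ^ 4 ≤
      3 * |(m : ℝ)| * #c.divisors * ((c : ℝ) ^ (11 / 12 : ℝ)) ^ 4 := by
    refine le_of_mul_le_mul_left ((totient_mul_norm_kloostermanSum_pow_four_le hm n).trans
      ((mul_le_mul_of_nonneg_left sum_norm_kloostermanSum_pow_four_le
        (abs_nonneg _)).trans_eq ?_)) hφ
    rw [hexp]
    ring
  refine le_of_pow_le_pow_left₀ four_ne_zero (by positivity) (hfour.trans ?_)
  calc 3 * |(m : ℝ)| * #c.divisors * ((c : ℝ) ^ (11 / 12 : ℝ)) ^ 4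
      ≤ 3 ^ 4 * |(m : ℝ)| * (#c.divisors : ℝ) ^ 4 * ((c : ℝ) ^ (11 / 12 : ℝ)) ^ 4 := by
        gcongr
        · norm_num
        · exact le_self_pow₀ hd four_ne_zero
    _ = _ := by rw [mul_pow, mul_pow, mul_pow, hroot]; ring

lemma norm_kloostermanSum_le {m n : ℤ} (h : m ≠ 0 ∨ n ≠ 0) :
    ‖kloostermanSum c m n‖ ≤
      3 * ((1 + |(m : ℝ)|) ^ (1 / 4 : ℝ) * (1 + |(n : ℝ)|) ^ (1 / 4 : ℝ)) *
      (#c.divisors * (c : ℝ) ^ (11 / 12 : ℝ)) := by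
  wlog hm : m ≠ 0 generalizing m n
  · rw [kloostermanSum_comm, mul_comm ((1 + |(m : ℝ)|) ^ (1 / 4 : ℝ))]
    exact this h.symm (h.resolve_left hm)
  refine (norm_kloostermanSum_le_of_left_ne_zero hm _).trans ?_
  gcongr
  calc |(m : ℝ)| ^ (1 / 4 : ℝ) ≤ (1 + |(m : ℝ)|) ^ (1 / 4 : ℝ) * 1 := by
        rw [mul_one]; gcongr; linarith
    _ ≤ _ := by gcongr; exact Real.one_le_rpow (by linarith [abs_nonneg (n : ℝ)]) (by norm_num)

end Kloosterman

/-! ### Decaying functions and Poisson summation -/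

section Decay

open MeasureTheory Filter

/-- The weight `(1 + |x|) ^ (-r)`, against which the decay of functions on the line is measured. -/
noncomputable def decay (r x : ℝ) : ℝ := (1 + |x|) ^ (-r)

variable {r : ℝ}

lemma decay_pos (r x : ℝ) : 0 < decay r x := by
  unfold decay
  positivity

lemma decay_nonneg (r x : ℝ) : 0 ≤ decay r x := (decay_pos r x).le

lemma decay_add_le (hr : 0 ≤ r) (x y : ℝ) : decay r (x + y) ≤ (1 + |x|) ^ r * decay r y := by
  have hbase : 1 + |y| ≤ (1 + |x|) * (1 + |x + y|) := by
    have : |y| ≤ |x| + |x + y| := by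
      calc |y| = |-x + (x + y)| := by rw [neg_add_cancel_left]
        _ ≤ |x| + |x + y| := (abs_add_le _ _).trans_eq (by rw [abs_neg])
    nlinarith [mul_nonneg (abs_nonneg x) (abs_nonneg (x + y))]
  calc decay r (x + y) = (1 + |x|) ^ r * ((1 + |x|) * (1 + |x + y|)) ^ (-r) := by
        rw [Real.mul_rpow (by positivity) (by positivity), ← mul_assoc,
          ← Real.rpow_add (by positivity), add_neg_cancel, Real.rpow_zero, one_mul, decay]
    _ ≤ (1 + |x|) ^ r * decay r y := by
        gcongr
        exact Real.rpow_le_rpow_of_nonpos (by positivity) hbase (neg_nonpos.2 hr)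

lemma decay_le_abs_rpow (hr : 0 ≤ r) {x : ℝ} (hx : x ≠ 0) : decay r x ≤ |x| ^ (-r) :=
  Real.rpow_le_rpow_of_nonpos (abs_pos.2 hx) (by linarith) (by linarith)

lemma integrable_decay (hr : 1 < r) : Integrable (decay r) := by
  simpa [decay] using! integrable_one_add_norm (E := ℝ) (μ := volume) (r := r) (by simpa using hr)

lemma summable_decay_int (hr : 1 < r) : Summable fun j : ℤ => decay r j := by
  refine (Real.summable_abs_int_rpow hr).of_norm_bounded_eventually ?_
  filter_upwards [(Set.finite_singleton (0 : ℤ)).compl_mem_cofinite] with j hj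
  rw [Real.norm_of_nonneg (decay_nonneg _ _)]
  exact decay_le_abs_rpow (by linarith) (by simpa using hj)

open scoped FourierTransform

lemma norm_fourier_le_of_norm_le_decay (hr : 1 < r) {f : ℝ → ℂ} {C : ℝ}
    (hf : ∀ x, ‖f x‖ ≤ C * decay r x) (ξ : ℝ) : ‖𝓕 f ξ‖ ≤ C * ∫ x, decay r x := by
  refine (VectorFourier.norm_fourierIntegral_le_integral_norm _ _ _ _ _).trans ?_
  rw [← integral_const_mul]
  exact integral_mono_of_nonneg (Eventually.of_forall fun x => norm_nonneg _)
    ((integrable_decay hr).const_mul C) (Eventually.of_forall hf)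

/-- `f` is twice continuously differentiable, and `f`, `f'` and `f''` are all bounded by
`C * decay r`: the regularity under which Poisson summation converges absolutely on both sides. -/
structure DecayingC2 (r C : ℝ) (f : ℝ → ℂ) : Prop where
  contDiff : ContDiff ℝ 2 f
  norm_iteratedDeriv_le : ∀ k ≤ 2, ∀ x, ‖iteratedDeriv k f x‖ ≤ C * decay r x

namespace DecayingC2

variable {C : ℝ} {f : ℝ → ℂ}

lemma norm_le (hf : DecayingC2 r C f) (x : ℝ) : ‖f x‖ ≤ C * decay r x := by
  simpa using hf.norm_iteratedDeriv_le 0 zero_le_two x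

lemma nonneg (hf : DecayingC2 r C f) : 0 ≤ C :=
  nonneg_of_mul_nonneg_left ((norm_nonneg _).trans (hf.norm_le 0)) (decay_pos r 0)

lemma integrable_iteratedDeriv (hr : 1 < r) (hf : DecayingC2 r C f) {k : ℕ} (hk : k ≤ 2) :
    Integrable (iteratedDeriv k f) :=
  ((integrable_decay hr).const_mul C).mono'
    (hf.contDiff.continuous_iteratedDeriv k (by exact_mod_cast hk)).aestronglyMeasurable
    (Eventually.of_forall (hf.norm_iteratedDeriv_le k hk))

lemma summable_add_intCast (hr : 1 < r) (hf : DecayingC2 r C f) (x : ℝ) :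
    Summable fun j : ℤ => f (x + j) := by
  refine .of_norm_bounded (((summable_decay_int hr).mul_left ((1 + |x|) ^ r)).mul_left C)
    fun j => (hf.norm_le _).trans ?_
  exact mul_le_mul_of_nonneg_left (decay_add_le (by linarith) x j) hf.nonneg

lemma norm_fourier_le (hr : 1 < r) (hf : DecayingC2 r C f) (ξ : ℝ) :
    ‖𝓕 f ξ‖ ≤ 4 * C * (∫ x, decay r x) * decay 2 ξ := by
  have hzero := norm_fourier_le_of_norm_le_decay hr hf.norm_le ξ
  have htwo : (2 * Real.pi * |ξ|) ^ 2 * ‖𝓕 f ξ‖ ≤ C * ∫ x, decay r x := by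
    have hfourier := Real.fourier_iteratedDeriv (N := 2) (n := 2) hf.contDiff
      (fun k hk => hf.integrable_iteratedDeriv hr (by exact_mod_cast hk)) le_rfl
    have := norm_fourier_le_of_norm_le_decay hr (hf.norm_iteratedDeriv_le 2 le_rfl) ξ
    rw [hfourier, norm_smul, norm_pow] at this
    simpa [abs_of_pos Real.pi_pos] using this
  have hweight : (1 + |ξ|) ^ 2 ≤ 2 * (1 + (2 * Real.pi * |ξ|) ^ 2) := by
    have : |ξ| ≤ 2 * Real.pi * |ξ| :=
      le_mul_of_one_le_left (abs_nonneg ξ) (by linarith [Real.pi_gt_three])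
    nlinarith [sq_nonneg (1 - |ξ|), pow_le_pow_left₀ (abs_nonneg ξ) this 2]
  have hdecay : decay 2 ξ = ((1 + |ξ|) ^ 2)⁻¹ := by
    rw [decay, Real.rpow_neg (by positivity), Real.rpow_ofNat]
  rw [hdecay, ← div_eq_mul_inv, le_div_iff₀ (by positivity)]
  calc ‖𝓕 f ξ‖ * (1 + |ξ|) ^ 2 ≤ ‖𝓕 f ξ‖ * (2 * (1 + (2 * Real.pi * |ξ|) ^ 2)) := by gcongr
    _ = 2 * ‖𝓕 f ξ‖ + 2 * ((2 * Real.pi * |ξ|) ^ 2 * ‖𝓕 f ξ‖) := by ring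
    _ ≤ 4 * C * ∫ x, decay r x := by linarith

lemma summable_norm_fourier (hr : 1 < r) (hf : DecayingC2 r C f) :
    Summable fun m : ℤ => ‖𝓕 f (m : ℝ)‖ :=
  .of_nonneg_of_le (fun _ => norm_nonneg _) (fun m => hf.norm_fourier_le hr m)
    ((summable_decay_int one_lt_two).mul_left _)

lemma tsum_add_intCast_eq (hr : 1 < r) (hf : DecayingC2 r C f) (x : ℝ) :
    ∑' j : ℤ, f (x + j) = ∑' m : ℤ, 𝓕 f (m : ℝ) * fourier m (x : UnitAddCircle) := by
  refine Real.tsum_eq_tsum_fourier_of_rpow_decay_of_summable hf.contDiff.continuous hr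
    (Asymptotics.IsBigO.of_bound C ?_) (hf.summable_norm_fourier hr).of_norm x
  filter_upwards [(isCompact_singleton (x := (0 : ℝ))).compl_mem_cocompact] with y hy
  rw [Real.norm_of_nonneg (by positivity)]
  exact (hf.norm_le y).trans (mul_le_mul_of_nonneg_left
    (decay_le_abs_rpow (by linarith) (by simpa using hy)) hf.nonneg)

end DecayingC2

end Decay

/-! ### Equidistribution of the points `(u / c, u⁻¹ / c)` -/

section UnitPairSum

open MeasureTheory

variable {c : ℕ} [NeZero c]

/-- The `j`-th integer in the residue class of `a`, counted from the representative in `[0, c)`. -/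
def residueLift (a : ZMod c) (j : ℤ) : ℤ := a.val + c * j

@[simp]
lemma intCast_residueLift (a : ZMod c) (j : ℤ) : (residueLift a j : ZMod c) = a := by
  simp [residueLift]

lemma residueLift_injective (a : ZMod c) : Function.Injective (residueLift a) := fun j k h => by
  simpa [residueLift, NeZero.ne c] using h

lemma exists_residueLift_eq (t : ℤ) : ∃ j, residueLift (t : ZMod c) j = t :=
  ⟨t / c, by rw [residueLift, ZMod.val_intCast, Int.emod_add_mul_ediv]⟩

lemma residueLift_div (a : ZMod c) (j : ℤ) :
    (residueLift a j / c : ℝ) = a.val / c + j := by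
  have : (c : ℝ) ≠ 0 := Nat.cast_ne_zero.2 (NeZero.ne c)
  simp only [residueLift, Int.cast_add, Int.cast_natCast, Int.cast_mul]
  field_simp

lemma decay_residueLift_div_le {r : ℝ} (hr : 0 ≤ r) (a : ZMod c) (j : ℤ) :
    decay r (residueLift a j / c) ≤ 2 ^ r * decay r j := by
  have hle : (a.val / c : ℝ) ≤ 1 :=
    div_le_one_of_le₀ (by exact_mod_cast (ZMod.val_lt a).le) (Nat.cast_nonneg c)
  rw [residueLift_div]
  refine (decay_add_le hr _ _).trans ?_
  have := decay_nonneg r j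
  gcongr
  rw [abs_of_nonneg (by positivity)]
  linarith

lemma stdAddChar_intCast_mul (m : ℤ) (a : ZMod c) :
    ZMod.stdAddChar ((m : ZMod c) * a) = fourier m ((a.val / c : ℝ) : UnitAddCircle) := by
  have : (m : ZMod c) * a = ((m * a.val : ℤ) : ZMod c) := by push_cast; simp
  rw [this, ZMod.stdAddChar_coe, fourier_coe_apply]
  push_cast
  ring_nf

/-- The sum of `f ⊗ g` over the points `(a / c, d / c)` with `a * d ≡ 1` modulo `c`. -/
noncomputable def unitPairSum (c : ℕ) [NeZero c] (f g : ℝ → ℂ) : ℂ :=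
  ∑ u : (ZMod c)ˣ, (∑' j : ℤ, f (residueLift (u : ZMod c) j / c)) *
    ∑' k : ℤ, g (residueLift ((u⁻¹ : (ZMod c)ˣ) : ZMod c) k / c)

open scoped FourierTransform

variable {r C D : ℝ} {f g : ℝ → ℂ}

lemma DecayingC2.tsum_residueLift_eq (hr : 1 < r) (hf : DecayingC2 r C f) (a : ZMod c) :
    ∑' j : ℤ, f (residueLift a j / c) =
      ∑' m : ℤ, 𝓕 f (m : ℝ) * ZMod.stdAddChar ((m : ZMod c) * a) := by
  simp only [residueLift_div, stdAddChar_intCast_mul, hf.tsum_add_intCast_eq hr]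

lemma DecayingC2.hasSum_unitPairSum (hr : 1 < r) (hf : DecayingC2 r C f)
    (hg : DecayingC2 r D g) (c : ℕ) [NeZero c] :
    HasSum (fun p : ℤ × ℤ => 𝓕 f (p.1 : ℝ) * 𝓕 g (p.2 : ℝ) * kloostermanSum c p.1 p.2)
      (unitPairSum c f g) := by
  have hsummable {h : ℝ → ℂ} {E : ℝ} (hh : DecayingC2 r E h) (a : ZMod c) :
      Summable fun m : ℤ => ‖𝓕 h (m : ℝ) * ZMod.stdAddChar ((m : ZMod c) * a)‖ := by
    simpa using hh.summable_norm_fourier hr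
  have hunit (u : (ZMod c)ˣ) : HasSum (fun p : ℤ × ℤ => 𝓕 f (p.1 : ℝ) * 𝓕 g (p.2 : ℝ) *
        (ZMod.stdAddChar ((p.1 : ZMod c) * (u : ZMod c) +
          (p.2 : ZMod c) * ((u⁻¹ : (ZMod c)ˣ) : ZMod c)) : ℂ))
      ((∑' j : ℤ, f (residueLift (u : ZMod c) j / c)) *
        ∑' k : ℤ, g (residueLift ((u⁻¹ : (ZMod c)ˣ) : ZMod c) k / c)) := by
    rw [hf.tsum_residueLift_eq hr, hg.tsum_residueLift_eq hr,
      tsum_mul_tsum_of_summable_norm (hsummable hf _) (hsummable hg _)]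
    convert! (summable_mul_of_summable_norm (hsummable hf _) (hsummable hg _)).hasSum using 2 with p
    rw [AddChar.map_add_eq_mul]
    ring
  simpa only [← Finset.mul_sum, kloostermanSum, unitPairSum] using
    hasSum_sum fun u (_ : u ∈ (Finset.univ : Finset (ZMod c)ˣ)) => hunit u

lemma DecayingC2.norm_fourier_mul_fourier_mul_kloostermanSum_le (hr : 1 < r)
    (hf : DecayingC2 r C f) (hg : DecayingC2 r D g) {m n : ℤ} (h : m ≠ 0 ∨ n ≠ 0) :
    ‖𝓕 f (m : ℝ) * 𝓕 g (n : ℝ) * kloostermanSum c m n‖ ≤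
      48 * (∫ x, decay r x) ^ 2 * C * D * (c.divisors.card * (c : ℝ) ^ (11 / 12 : ℝ)) *
        (decay (7 / 4) m * decay (7 / 4) n) := by
  have hI : 0 ≤ ∫ x, decay r x := integral_nonneg (decay_nonneg r)
  have hC := hf.nonneg
  have hD := hg.nonneg
  have hweight (m : ℤ) : decay (7 / 4) m = decay 2 m * (1 + |(m : ℝ)|) ^ (1 / 4 : ℝ) := by
    rw [decay, decay, ← Real.rpow_add (by positivity)]
    norm_num
  have hm := decay_nonneg 2 m
  have hn := decay_nonneg 2 n
  rw [norm_mul, norm_mul, hweight m, hweight n]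
  calc ‖𝓕 f (m : ℝ)‖ * ‖𝓕 g (n : ℝ)‖ * ‖kloostermanSum c m n‖
      ≤ (4 * C * (∫ x, decay r x) * decay 2 m) * (4 * D * (∫ x, decay r x) * decay 2 n) *
        (3 * ((1 + |(m : ℝ)|) ^ (1 / 4 : ℝ) * (1 + |(n : ℝ)|) ^ (1 / 4 : ℝ)) *
          (c.divisors.card * (c : ℝ) ^ (11 / 12 : ℝ))) := by
        gcongr
        exacts [hf.norm_fourier_le hr m,
          hg.norm_fourier_le hr n, norm_kloostermanSum_le h]
    _ = _ := by ring

lemma norm_unitPairSum_sub_le (hr : 1 < r) (hf : DecayingC2 r C f) (hg : DecayingC2 r D g)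
    (c : ℕ) [NeZero c] :
    ‖unitPairSum c f g - c.totient * (∫ x, f x) * ∫ x, g x‖ ≤
      48 * (∫ x, decay r x) ^ 2 * C * D * (c.divisors.card * (c : ℝ) ^ (11 / 12 : ℝ)) *
        (∑' m : ℤ, decay (7 / 4) m) ^ 2 := by
  have hC := hf.nonneg
  have hD := hg.nonneg
  have hzero : (c.totient : ℂ) * (∫ x, f x) * (∫ x, g x) = 𝓕 f ((0 : ℤ) : ℝ) *
      𝓕 g ((0 : ℤ) : ℝ) * kloostermanSum c ((0 : ℤ) : ZMod c) ((0 : ℤ) : ZMod c) := by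
    simp only [Int.cast_zero, kloostermanSum_zero_zero, Real.fourier_eq, inner_zero_right,
      neg_zero, AddChar.map_zero_eq_one, one_smul]
    ring
  have hsum := (hf.hasSum_unitPairSum hr hg c).update (0, 0) 0
  have hweights : HasSum (fun p : ℤ × ℤ => decay (7 / 4) p.1 * decay (7 / 4) p.2)
      ((∑' m : ℤ, decay (7 / 4) m) ^ 2) := by
    have hs : Summable fun m : ℤ => decay (7 / 4) m := summable_decay_int (by norm_num)
    rw [sq, tsum_mul_tsum_of_summable_norm hs.norm hs.norm]
    exact (hs.mul_of_nonneg hs (fun m => decay_nonneg _ m) fun m => decay_nonneg _ m).hasSum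
  simp only [zero_sub, ← hzero, neg_add_eq_sub] at hsum
  rw [← hsum.tsum_eq]
  refine tsum_of_norm_bounded (hweights.mul_left _) fun ⟨m, n⟩ => ?_
  by_cases hmn : (m, n) = (0, 0)
  · rw [hmn, Function.update_self, norm_zero]
    have := decay_nonneg (7 / 4)
    exact mul_nonneg (by positivity) (mul_nonneg (this _) (this _))
  · rw [Function.update_of_ne hmn]
    refine hf.norm_fourier_mul_fourier_mul_kloostermanSum_le hr hg ?_
    simpa [Prod.ext_iff, imp_iff_not_or] using hmn

end UnitPairSum

/-! ### Products of complex powers on a horizontal line -/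

section CpowPair

/-- The function `(x + z) ^ α * (x + conj z) ^ β` of a real variable `x`. -/
noncomputable def cpowPair (z α β : ℂ) (x : ℝ) : ℂ := (x + z) ^ α * (x + conj z) ^ β

variable {z : ℂ}

lemma ofReal_add_mem_slitPlane (hz : z.im ≠ 0) (x : ℝ) : (x : ℂ) + z ∈ Complex.slitPlane :=
  Or.inr (by simpa using hz)

lemma ofReal_add_conj_mem_slitPlane (hz : z.im ≠ 0) (x : ℝ) :
    (x : ℂ) + conj z ∈ Complex.slitPlane :=
  ofReal_add_mem_slitPlane (by simpa using hz) x

lemma contDiff_cpowPair (hz : z.im ≠ 0) (α β : ℂ) {n : WithTop ℕ∞} :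
    ContDiff ℝ n (cpowPair z α β) := by
  have hpow (w γ : ℂ) (hw : ∀ x : ℝ, (x : ℂ) + w ∈ Complex.slitPlane) :
      ContDiff ℝ n fun x : ℝ => ((x : ℂ) + w) ^ γ := by
    refine contDiff_iff_contDiffAt.2 fun x => ?_
    have : AnalyticAt ℂ (fun t : ℂ => (t + w) ^ γ) x :=
      (analyticAt_id.add analyticAt_const).cpow analyticAt_const (hw x)
    exact (this.contDiffAt.restrict_scalars ℝ).comp x Complex.ofRealCLM.contDiff.contDiffAt
  exact (hpow z α (ofReal_add_mem_slitPlane hz)).mul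
    (hpow (conj z) β (ofReal_add_conj_mem_slitPlane hz))

lemma deriv_cpowPair (hz : z.im ≠ 0) (α β : ℂ) :
    deriv (cpowPair z α β) = α • cpowPair z (α - 1) β + β • cpowPair z α (β - 1) := by
  ext x
  have hpow (w γ : ℂ) (hw : (x : ℂ) + w ∈ Complex.slitPlane) :
      HasDerivAt (fun t : ℂ => (t + w) ^ γ) (γ * ((x : ℂ) + w) ^ (γ - 1)) x := by
    simpa using! ((hasDerivAt_id (x : ℂ)).add_const w).cpow_const (c := γ) hw
  refine (((hpow z α (ofReal_add_mem_slitPlane hz x)).mul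
    (hpow (conj z) β (ofReal_add_conj_mem_slitPlane hz x))).comp_ofReal.deriv).trans ?_
  simp only [cpowPair, Pi.add_apply, Pi.smul_apply, smul_eq_mul]
  ring

lemma one_add_abs_le_mul_norm_ofReal_add (hz : 0 < z.im) (x : ℝ) :
    1 + |x| ≤ (1 + (1 + ‖z‖) / z.im) * ‖(x : ℂ) + z‖ := by
  have habs : |x| ≤ ‖(x : ℂ) + z‖ + ‖z‖ := by
    calc |x| = ‖(x : ℂ) + z - z‖ := by simp
      _ ≤ _ := norm_sub_le _ _
  have him : z.im ≤ ‖(x : ℂ) + z‖ := by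
    simpa [abs_of_pos hz] using Complex.abs_im_le_norm ((x : ℂ) + z)
  have : 1 + ‖z‖ ≤ (1 + ‖z‖) / z.im * ‖(x : ℂ) + z‖ := by
    rw [div_mul_eq_mul_div, le_div_iff₀ hz]
    gcongr
  linarith

lemma norm_cpow_le_of_norm_le {B : ℝ} (w : ℂ) {α : ℂ} (hα : ‖α‖ ≤ B) :
    ‖w ^ α‖ ≤ ‖w‖ ^ α.re * Real.exp (Real.pi * B) := by
  refine (Complex.norm_cpow_le w α).trans ?_
  rw [div_eq_mul_inv, ← Real.exp_neg]
  gcongr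
  calc -(w.arg * α.im) ≤ |w.arg * α.im| := neg_le_abs _
    _ = |w.arg| * |α.im| := abs_mul _ _
    _ ≤ Real.pi * B := by
      gcongr
      · exact Complex.abs_arg_le_pi w
      · exact (Complex.abs_im_le_norm α).trans hα

lemma norm_cpowPair_le {B : ℝ} {α β : ℂ} (hz : z.im ≠ 0) (hα : ‖α‖ ≤ B) (hβ : ‖β‖ ≤ B) (x : ℝ) :
    ‖cpowPair z α β x‖ ≤ Real.exp (Real.pi * B) ^ 2 * ‖(x : ℂ) + z‖ ^ (α + β).re := by
  have hpos : 0 < ‖(x : ℂ) + z‖ := norm_pos_iff.2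
    (Complex.slitPlane_ne_zero (ofReal_add_mem_slitPlane hz x))
  have hconj : ‖(x : ℂ) + conj z‖ = ‖(x : ℂ) + z‖ := by
    rw [← Complex.norm_conj, map_add, Complex.conj_conj, Complex.conj_ofReal]
  calc ‖cpowPair z α β x‖ ≤ (‖(x : ℂ) + z‖ ^ α.re * Real.exp (Real.pi * B)) *
        (‖(x : ℂ) + conj z‖ ^ β.re * Real.exp (Real.pi * B)) := by
        rw [cpowPair, norm_mul]
        gcongr <;> exact norm_cpow_le_of_norm_le _ ‹_›
    _ = _ := by rw [hconj, Complex.add_re, Real.rpow_add hpos]; ring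

lemma exists_norm_cpowPair_le_decay (hz : 0 < z.im) {r : ℝ} (hr : 0 ≤ r) (B : ℝ) :
    ∃ C : ℝ, ∀ α β : ℂ, ‖α‖ ≤ B → ‖β‖ ≤ B → (α + β).re ≤ -r →
      ∀ x, ‖cpowPair z α β x‖ ≤ C * decay r x := by
  set K := 1 + (1 + ‖z‖) / z.im
  have hK : 1 ≤ K := le_add_of_nonneg_right (by positivity)
  refine ⟨Real.exp (Real.pi * B) ^ 2 * K ^ (2 * B), fun α β hα hβ hαβ x => ?_⟩
  have hlower : (1 + |x|) / K ≤ ‖(x : ℂ) + z‖ := by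
    rw [div_le_iff₀ (by positivity), mul_comm]
    exact one_add_abs_le_mul_norm_ofReal_add hz x
  have hexp : -(α + β).re ≤ 2 * B := by
    rw [Complex.add_re]
    linarith [(abs_le.1 (Complex.abs_re_le_norm α)).1, (abs_le.1 (Complex.abs_re_le_norm β)).1]
  have hx : 1 ≤ 1 + |x| := le_add_of_nonneg_right (abs_nonneg x)
  refine (norm_cpowPair_le hz.ne' hα hβ x).trans ?_
  rw [mul_assoc]
  gcongr
  calc ‖(x : ℂ) + z‖ ^ (α + β).re ≤ ((1 + |x|) / K) ^ (α + β).re :=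
        Real.rpow_le_rpow_of_nonpos (by positivity) hlower (by linarith)
    _ = K ^ (-(α + β).re) * (1 + |x|) ^ (α + β).re := by
        rw [Real.div_rpow (by positivity) (by positivity), Real.rpow_neg (by positivity),
          div_eq_inv_mul]
    _ ≤ K ^ (2 * B) * decay r x := by
        unfold decay
        gcongr

lemma exists_norm_iteratedDeriv_cpowPair_le_decay (hz : 0 < z.im) {r : ℝ} (hr : 0 ≤ r) (n : ℕ)
    (B : ℝ) : ∃ C : ℝ, ∀ α β : ℂ, ‖α‖ ≤ B → ‖β‖ ≤ B → (α + β).re ≤ -r →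
      ∀ x, ‖iteratedDeriv n (cpowPair z α β) x‖ ≤ C * decay r x := by
  induction n generalizing B with
  | zero => simpa using exists_norm_cpowPair_le_decay hz hr B
  | succ n ih =>
    obtain ⟨C, hC⟩ := ih (B + 1)
    refine ⟨2 * B * C, fun α β hα hβ hαβ x => ?_⟩
    have hsub {γ : ℂ} (hγ : ‖γ‖ ≤ B) : ‖γ - 1‖ ≤ B + 1 :=
      (norm_sub_le _ _).trans (by rw [norm_one]; linarith)
    have hre : (α - 1 + β).re ≤ -r ∧ (α + (β - 1)).re ≤ -r := by
      simp only [Complex.add_re, Complex.sub_re, Complex.one_re] at hαβ ⊢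
      constructor <;> linarith
    have hleft := hC (α - 1) β (hsub hα) (by linarith) hre.1 x
    have hright := hC α (β - 1) (by linarith) (hsub hβ) hre.2 x
    have hdiff (γ α β : ℂ) : ContDiffAt ℝ n (γ • cpowPair z α β) x :=
      contDiffAt_const.smul (contDiff_cpowPair hz.ne' α β).contDiffAt
    rw [iteratedDeriv_succ', deriv_cpowPair hz.ne', iteratedDeriv_add (hdiff _ _ _) (hdiff _ _ _),
      iteratedDeriv_const_smul_field, iteratedDeriv_const_smul_field]
    calc _ ≤ ‖α‖ * ‖iteratedDeriv n (cpowPair z (α - 1) β) x‖ +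
          ‖β‖ * ‖iteratedDeriv n (cpowPair z α (β - 1)) x‖ := by
          simpa only [norm_smul] using norm_add_le (α • iteratedDeriv n (cpowPair z (α - 1) β) x)
            (β • iteratedDeriv n (cpowPair z α (β - 1)) x)
      _ ≤ B * (C * decay r x) + B * (C * decay r x) := by
          have := (norm_nonneg _).trans hleft
          have := (norm_nonneg _).trans hα
          gcongr
      _ = 2 * B * C * decay r x := by ring

lemma exists_decayingC2_cpowPair (hz : 0 < z.im) {r : ℝ} (hr : 0 ≤ r) (B : ℝ) :
    ∃ C : ℝ, ∀ α β : ℂ, ‖α‖ ≤ B → ‖β‖ ≤ B → (α + β).re ≤ -r →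
      DecayingC2 r C (cpowPair z α β) := by
  choose C hC using fun n => exists_norm_iteratedDeriv_cpowPair_le_decay hz hr n B
  refine ⟨max (C 0) (max (C 1) (C 2)), fun α β hα hβ hαβ =>
    ⟨contDiff_cpowPair hz.ne' α β, fun k hk x => ?_⟩⟩
  refine (hC k α β hα hβ hαβ x).trans (mul_le_mul_of_nonneg_right ?_ (decay_nonneg r x))
  interval_cases k <;> simp

end CpowPair

section ParametricIntegral

open MeasureTheory Filter Topology

variable {X : Type*} [MeasurableSpace X] {μ : Measure X} {U : Set ℂ} {F : ℂ → X → ℂ}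

lemma aestronglyMeasurable_deriv_of_differentiableAt (hU : IsOpen U)
    (hmeas : ∀ s ∈ U, AEStronglyMeasurable (F s) μ) {s : ℂ} (hs : s ∈ U)
    (hdiff : ∀ x, DifferentiableAt ℂ (fun s => F s x) s) :
    AEStronglyMeasurable (fun x => deriv (fun s => F s x) s) μ := by
  have hne : (𝓝[U \ {s}] s).NeBot := by
    rw [Set.sdiff_eq, Set.inter_comm, nhdsWithin_inter_of_mem' (mem_nhdsWithin_of_mem_nhds
      (hU.mem_nhds hs))]
    infer_instance
  have hle : 𝓝[U \ {s}] s ≤ 𝓟 (U \ {s}) := inf_le_right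
  have := comap_coe_neBot_of_le_principal hle
  refine aestronglyMeasurable_of_tendsto_ae (comap ((↑) : ↥(U \ {s}) → ℂ) (𝓝[U \ {s}] s))
    (f := fun t x => slope (fun s => F s x) s t) (fun t => ?_) (Eventually.of_forall fun x =>
      (hasDerivWithinAt_iff_tendsto_slope.1 (hdiff x).hasDerivAt.hasDerivWithinAt).comp
        tendsto_comap)
  simp only [slope_def_module]
  exact ((hmeas t t.2.1).sub (hmeas s hs)).const_smul ((t : ℂ) - s)⁻¹

-- Cauchy's estimate on small circles dominates the derivative by a multiple of the same `g`.
lemma differentiableOn_integral_of_norm_le (hU : IsOpen U)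
    (hmeas : ∀ s ∈ U, AEStronglyMeasurable (F s) μ)
    (hdiff : ∀ x, DifferentiableOn ℂ (fun s => F s x) U) {g : X → ℝ} (hg : Integrable g μ)
    (hle : ∀ s ∈ U, ∀ x, ‖F s x‖ ≤ g x) : DifferentiableOn ℂ (fun s => ∫ x, F s x ∂μ) U := by
  intro s₀ hs₀
  obtain ⟨r, hr, hball⟩ := Metric.isOpen_iff.1 hU s₀ hs₀
  have hat {s : ℂ} (hs : s ∈ U) (x : X) : DifferentiableAt ℂ (fun s => F s x) s :=
    (hdiff x).differentiableAt (hU.mem_nhds hs)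
  have hnear {s : ℂ} (hs : s ∈ Metric.ball s₀ (r / 2)) : Metric.closedBall s (r / 4) ⊆ U :=
    (Metric.closedBall_subset_ball' (by linarith [Metric.mem_ball.1 hs])).trans hball
  have hderiv_le (x : X) (s : ℂ) (hs : s ∈ Metric.ball s₀ (r / 2)) :
      ‖deriv (fun s => F s x) s‖ ≤ g x / (r / 4) :=
    Complex.norm_deriv_le_of_forall_mem_sphere_norm_le (by positivity)
      ((hdiff x).diffContOnCl_ball (hnear hs))
      fun t ht => hle t (hnear hs (Metric.sphere_subset_closedBall ht)) x
  exact (hasDerivAt_integral_of_dominated_loc_of_deriv_le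
    (Metric.ball_mem_nhds s₀ (half_pos hr)) ((hU.eventually_mem hs₀).mono hmeas)
    (hg.mono' (hmeas s₀ hs₀) (Eventually.of_forall (hle s₀ hs₀)))
    (aestronglyMeasurable_deriv_of_differentiableAt hU hmeas hs₀ (hat hs₀))
    (Eventually.of_forall hderiv_le) (hg.div_const _)
    (Eventually.of_forall fun x s hs =>
      (hat (hnear hs (Metric.mem_closedBall_self (by positivity))) x).hasDerivAt)).2
    |>.differentiableAt.differentiableWithinAt

end ParametricIntegral

/-! ### The Dirichlet series of the totient on multiples of `N` -/

section DirichletSeries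

open ArithmeticFunction

lemma summable_card_divisors_mul_rpow {p : ℝ} (hp : 1 < p) :
    Summable fun n : ℕ => (n.divisors.card : ℝ) * (n : ℝ) ^ (-p) := by
  have hone : LSeriesSummable 1 (p : ℂ) := LSeriesSummable_one_iff.2 (by simpa using hp)
  refine (hone.convolution hone).norm.congr fun n => ?_
  rw [LSeries.norm_term_eq]
  rcases eq_or_ne n 0 with rfl | hn
  · simp
  · have hcard : n.divisorsAntidiagonal.card = n.divisors.card := by
      rw [Finset.card_eq_sum_ones, Finset.card_eq_sum_ones]
      exact Nat.sum_divisorsAntidiagonal (fun _ _ => 1)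
    rw [if_neg hn, LSeries.convolution_def]
    simp [Real.rpow_neg, div_eq_mul_inv, hcard]

/-- The Dirichlet quotient of the totient function restricted to multiples of `N` by the identity:
its convolution with `n ↦ n` is `c ↦ φ(c)` on multiples of `N` and `0` elsewhere. -/
noncomputable def totientCoeff (N n : ℕ) : ℂ :=
  ∑ e ∈ n.divisors with N.lcm e = n, (moebius e : ℂ) * (n / e : ℕ)

-- `e` is recovered from `gcd(N, e)` and `lcm(N, e) = n`.
lemma card_divisors_filter_lcm_eq_le {N : ℕ} (hN : N ≠ 0) (n : ℕ) :
    (n.divisors.filter fun e => N.lcm e = n).card ≤ N.divisors.card := by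
  refine Finset.card_le_card_of_injOn (N.gcd ·) (fun e _ => ?_) fun e he e' he' hgcd => ?_
  · simp [hN, Nat.gcd_dvd_left]
  · simp only [Finset.coe_filter, Set.mem_ofPred_eq] at he he' hgcd
    refine Nat.eq_of_mul_eq_mul_left (Nat.pos_of_ne_zero hN) ?_
    rw [← Nat.gcd_mul_lcm N e, ← Nat.gcd_mul_lcm N e', he.2, he'.2, hgcd]

lemma norm_totientCoeff_le {N : ℕ} (hN : N ≠ 0) (n : ℕ) :
    ‖totientCoeff N n‖ ≤ N.divisors.card * N := by
  have hterm (e : ℕ) (he : e ∈ n.divisors.filter fun e => N.lcm e = n) :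
      ‖(moebius e : ℂ) * (n / e : ℕ)‖ ≤ N := by
    obtain ⟨hdvd, hlcm⟩ := Finset.mem_filter.1 he
    have hpos := Nat.pos_of_mem_divisors hdvd
    have hmoebius : ‖(moebius e : ℂ)‖ ≤ 1 := by
      rw [Complex.norm_intCast]
      exact_mod_cast abs_moebius_le_one
    have hdiv : n / e ≤ N := by
      refine Nat.div_le_of_le_mul ?_
      rw [← hlcm, mul_comm]
      exact Nat.le_of_dvd (by positivity) (Nat.lcm_dvd_mul N e)
    rw [norm_mul, Complex.norm_natCast, ← one_mul (N : ℝ)]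
    gcongr
  calc ‖totientCoeff N n‖ ≤ ∑ e ∈ n.divisors with N.lcm e = n, (N : ℝ) :=
        norm_sum_le_of_le _ hterm
    _ ≤ N.divisors.card * N := by
        rw [Finset.sum_const, nsmul_eq_mul]
        exact mul_le_mul_of_nonneg_right
          (by exact_mod_cast card_divisors_filter_lcm_eq_le hN n) N.cast_nonneg

lemma totient_eq_sum_moebius_mul {c : ℕ} (hc : c ≠ 0) :
    (c.totient : ℂ) = ∑ e ∈ c.divisors, (moebius e : ℂ) * (c / e : ℕ) := by
  have hinv := (sum_eq_iff_sum_mul_moebius_eq (R := ℂ)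
    (f := fun n => (n.totient : ℂ)) (g := fun n => (n : ℂ))).1
    (fun n _ => by exact_mod_cast Nat.sum_totient n) c (Nat.pos_of_ne_zero hc)
  rw [← hinv, Nat.sum_divisorsAntidiagonal (f := fun a b => (moebius a : ℂ) * (b : ℂ))]

lemma convolution_totientCoeff {N c : ℕ} (hc : c ≠ 0) :
    LSeries.convolution (totientCoeff N) (fun n => (n : ℂ)) c =
      if N ∣ c then (c.totient : ℂ) else 0 := by
  simp only [LSeries.convolution_def]
  rw [Nat.sum_divisorsAntidiagonal (f := fun a b => totientCoeff N a * (b : ℂ))]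
  simp only [totientCoeff, Finset.sum_mul]
  split_ifs with hdvd
  · have hlcm {e : ℕ} (he : e ∣ c) : N.lcm e ∣ c := Nat.lcm_dvd hdvd he
    have hmem (n e : ℕ) : n ∈ c.divisors ∧ e ∈ (n.divisors.filter fun e => N.lcm e = n) ↔
        n ∈ ({N.lcm e} : Finset ℕ) ∧ e ∈ c.divisors := by
      simp only [Nat.mem_divisors, Finset.mem_filter, Finset.mem_singleton]
      constructor
      · rintro ⟨⟨hn, -⟩, ⟨he, -⟩, rfl⟩
        exact ⟨rfl, he.trans hn, hc⟩
      · rintro ⟨rfl, he, -⟩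
        exact ⟨⟨hlcm he, hc⟩, ⟨Nat.dvd_lcm_right N e, ne_zero_of_dvd_ne_zero hc (hlcm he)⟩, rfl⟩
    rw [Finset.sum_comm' hmem, totient_eq_sum_moebius_mul hc]
    refine Finset.sum_congr rfl fun e he => ?_
    have hn := hlcm (Nat.dvd_of_mem_divisors he)
    rw [Finset.sum_singleton, mul_assoc, ← Nat.cast_mul, mul_comm (N.lcm e / e),
      Nat.div_mul_div_comm hn (Nat.dvd_lcm_right N e), mul_comm (N.lcm e),
      Nat.mul_div_mul_right _ _ (Nat.pos_of_ne_zero (ne_zero_of_dvd_ne_zero hc hn))]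
  · refine Finset.sum_eq_zero fun n hn => Finset.sum_eq_zero fun e he => absurd ?_ hdvd
    rw [← (Finset.mem_filter.1 he).2] at hn
    exact (Nat.dvd_lcm_left N e).trans (Nat.dvd_of_mem_divisors hn)

lemma lseriesSummable_totientCoeff {N : ℕ} (hN : N ≠ 0) {t : ℂ} (ht : 1 < t.re) :
    LSeriesSummable (totientCoeff N) t :=
  LSeriesSummable_of_bounded_of_one_lt_re (fun n _ => norm_totientCoeff_le hN n) ht

lemma differentiableOn_lseries_totientCoeff {N : ℕ} (hN : N ≠ 0) :
    DifferentiableOn ℂ (LSeries (totientCoeff N)) {t | 1 < t.re} := by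
  refine (LSeries_differentiableOn _).mono fun t ht => ?_
  refine lt_of_le_of_lt (LSeries.abscissaOfAbsConv_le_of_le_const
    ⟨N.divisors.card * N, fun n _ => norm_totientCoeff_le hN n⟩) ?_
  exact_mod_cast ht

lemma lseriesHasSum_natCast {t : ℂ} (ht : 2 < t.re) :
    LSeriesHasSum (fun n => (n : ℂ)) t (riemannZeta (t - 1)) := by
  have ht' : 1 < (t - 1).re := by simpa using (by linarith : 1 < t.re - 1)
  have hterm (n : ℕ) : LSeries.term (fun n => (n : ℂ)) t n = LSeries.term 1 (t - 1) n := by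
    rcases eq_or_ne n 0 with rfl | hn
    · simp
    · have hn' : (n : ℂ) ≠ 0 := by exact_mod_cast hn
      rw [LSeries.term_of_ne_zero hn, LSeries.term_of_ne_zero hn, Complex.cpow_sub _ _ hn',
        Complex.cpow_one, Pi.one_apply, one_div_div]
  rw [LSeriesHasSum, funext hterm]
  exact LSeriesHasSum_one ht'

/-- The positive multiples of `N`: the absolute values of the nonzero lower left entries of the
matrices in `Γ₀(N)`. -/
abbrev Modulus (N : ℕ) : Type := {c : ℕ // N ∣ c ∧ c ≠ 0}

instance {N : ℕ} (c : Modulus N) : NeZero (c : ℕ) := ⟨c.2.2⟩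

lemma hasSum_totient_mul_cpow {N : ℕ} (hN : N ≠ 0) {t : ℂ} (ht : 2 < t.re) :
    HasSum (fun c : Modulus N => ((c : ℕ).totient : ℂ) * ((c : ℕ) : ℂ) ^ (-t))
      (riemannZeta (t - 1) * LSeries (totientCoeff N) t) := by
  have hcoeff := (lseriesSummable_totientCoeff hN (t := t) (by linarith)).LSeriesHasSum
  have hconv := hcoeff.convolution (lseriesHasSum_natCast ht)
  have hterm : LSeries.term (LSeries.convolution (totientCoeff N) fun n => (n : ℂ)) t =
      Set.indicator {c : ℕ | N ∣ c ∧ c ≠ 0} fun c : ℕ => (c.totient : ℂ) * (c : ℂ) ^ (-t) := by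
    ext c
    rcases eq_or_ne c 0 with rfl | hc
    · simp
    · simp [Set.indicator_apply, convolution_totientCoeff hc, hc, Complex.cpow_neg,
        div_eq_mul_inv]
  rw [mul_comm]
  rw [LSeriesHasSum, hterm] at hconv
  exact (hasSum_subtype_iff_indicator (s := {c : ℕ | N ∣ c ∧ c ≠ 0})).2 hconv

open DirichletCharacter in
lemma lFunctionTrivChar₁_one_of_ne_one {t : ℂ} (ht : t ≠ 1) :
    LFunctionTrivChar₁ 1 t = (t - 1) * riemannZeta t := by
  rw [LFunctionTrivChar₁, Function.update_of_ne ht, LFunctionTrivChar, LFunction_modOne_eq]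

end DirichletSeries

/-! ### Holomorphic families of decaying functions -/

section HolomorphicFamily

/-- A family of decaying functions `f s` on the line which depends holomorphically on `s ∈ U` and
whose decay is uniform for `s` in compact subsets of `U`. -/
structure HolomorphicDecayingC2 (U : Set ℂ) (r : ℝ) (f : ℂ → ℝ → ℂ) : Prop where
  differentiableOn : ∀ x, DifferentiableOn ℂ (fun s => f s x) U
  exists_decayingC2 : ∀ K ⊆ U, IsCompact K → ∃ C, ∀ s ∈ K, DecayingC2 r C (f s)

variable {U : Set ℂ} {r : ℝ} {f g : ℂ → ℝ → ℂ}

lemma differentiableOn_of_forall_isCompact {F : ℂ → ℂ} (hU : IsOpen U)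
    (hF : ∀ K ⊆ U, IsCompact K → DifferentiableOn ℂ F (interior K)) : DifferentiableOn ℂ F U := by
  intro s hs
  obtain ⟨K, hK, hsK, hKU⟩ := exists_compact_subset hU hs
  exact ((hF K hKU hK).differentiableAt (isOpen_interior.mem_nhds hsK)).differentiableWithinAt

namespace HolomorphicDecayingC2

lemma differentiableOn_integral (hU : IsOpen U) (hr : 1 < r) (hf : HolomorphicDecayingC2 U r f) :
    DifferentiableOn ℂ (fun s => ∫ x, f s x) U := by
  refine differentiableOn_of_forall_isCompact hU fun K hKU hK => ?_
  obtain ⟨C, hC⟩ := hf.exists_decayingC2 K hKU hK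
  exact differentiableOn_integral_of_norm_le isOpen_interior
    (fun s hs => (hC s (interior_subset hs)).contDiff.continuous.aestronglyMeasurable)
    (fun x => (hf.differentiableOn x).mono (interior_subset.trans hKU))
    ((integrable_decay hr).const_mul C) fun s hs => (hC s (interior_subset hs)).norm_le

lemma differentiableOn_tsum_residueLift (hU : IsOpen U) (hr : 1 < r)
    (hf : HolomorphicDecayingC2 U r f) {c : ℕ} [NeZero c] (a : ZMod c) :
    DifferentiableOn ℂ (fun s => ∑' j : ℤ, f s (residueLift a j / c)) U := by
  refine SummableLocallyUniformlyOn.differentiableOn hU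
    (SummableLocallyUniformlyOn_of_locally_bounded hU fun K hKU hK => ?_)
    fun j s hs => (hf.differentiableOn _).differentiableAt (hU.mem_nhds hs)
  obtain ⟨C, hC⟩ := hf.exists_decayingC2 K hKU hK
  refine ⟨fun j => C * (2 ^ r * decay r j), ((summable_decay_int hr).mul_left _).mul_left _,
    fun j s hs => ((hC s hs).norm_le _).trans ?_⟩
  exact mul_le_mul_of_nonneg_left (decay_residueLift_div_le (by linarith) a j) (hC s hs).nonneg

lemma differentiableOn_unitPairSum (hU : IsOpen U) (hr : 1 < r) (hf : HolomorphicDecayingC2 U r f)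
    (hg : HolomorphicDecayingC2 U r g) (c : ℕ) [NeZero c] :
    DifferentiableOn ℂ (fun s => unitPairSum c (f s) (g s)) U := by
  unfold unitPairSum
  exact DifferentiableOn.fun_sum fun u _ => (hf.differentiableOn_tsum_residueLift hU hr _).mul
    (hg.differentiableOn_tsum_residueLift hU hr _)

end HolomorphicDecayingC2

lemma differentiable_natCast_cpow {c : ℕ} (hc : c ≠ 0) :
    Differentiable ℂ fun s : ℂ => (c : ℂ) ^ (2 - 4 * s) :=
  Differentiable.const_cpow (by fun_prop) (Or.inl (Nat.cast_ne_zero.2 hc))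

lemma exists_lt_forall_le_re_of_isCompact {σ : ℝ} {K : Set ℂ} (hK : IsCompact K)
    (hKσ : K ⊆ {s | σ < s.re}) : ∃ σ' > σ, ∀ s ∈ K, σ' ≤ s.re := by
  rcases K.eq_empty_or_nonempty with rfl | hne
  · exact ⟨σ + 1, lt_add_one σ, by simp⟩
  · obtain ⟨s, hs, hmin⟩ := hK.exists_isMinOn hne Complex.continuous_re.continuousOn
    exact ⟨s.re, hKσ hs, fun t ht => hmin ht⟩

/-- The deviation of `unitPairSum` from the value predicted by equidistribution, weighted by the
power of `c` with which it enters the kernel. -/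
noncomputable def equidistributionError (f g : ℂ → ℝ → ℂ) (c : ℕ) [NeZero c] (s : ℂ) : ℂ :=
  (c : ℂ) ^ (2 - 4 * s) *
    (unitPairSum c (f s) (g s) - c.totient * (∫ x, f s x) * ∫ x, g s x)

-- The exponent `47 / 48` solves `4 * σ - 2 - 11 / 12 = 1`.
lemma summableLocallyUniformlyOn_equidistributionError (N : ℕ) (hr : 1 < r)
    (hf : HolomorphicDecayingC2 {s | 47 / 48 < s.re} r f)
    (hg : HolomorphicDecayingC2 {s | 47 / 48 < s.re} r g) :
    SummableLocallyUniformlyOn (fun (c : Modulus N) s => equidistributionError f g c s)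
      {s | 47 / 48 < s.re} := by
  refine SummableLocallyUniformlyOn_of_locally_bounded
    (Complex.isOpen_re_gt _) fun K hKU hK => ?_
  obtain ⟨C, hC⟩ := hf.exists_decayingC2 K hKU hK
  obtain ⟨D, hD⟩ := hg.exists_decayingC2 K hKU hK
  obtain ⟨σ, hσ, hKσ⟩ := exists_lt_forall_le_re_of_isCompact hK hKU
  set A := 48 * (∫ x, decay r x) ^ 2 * C * D * (∑' m : ℤ, decay (7 / 4) m) ^ 2
  refine ⟨fun c => A * ((c : ℕ).divisors.card * ((c : ℕ) : ℝ) ^ (-(4 * σ - 2 - 11 / 12))),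
    ((summable_card_divisors_mul_rpow (by linarith)).subtype _).mul_left A, fun c s hs => ?_⟩
  have hc : 0 < (c : ℕ) := Nat.pos_of_ne_zero c.2.2
  have hc1 : (1 : ℝ) ≤ (c : ℕ) := by exact_mod_cast hc
  have hexp : (2 - 4 * s).re ≤ 2 - 4 * σ := by
    have := hKσ s hs
    simp only [Complex.sub_re, Complex.mul_re, Complex.re_ofNat, Complex.im_ofNat]
    linarith
  calc ‖equidistributionError f g c s‖
      ≤ ((c : ℕ) : ℝ) ^ (2 - 4 * σ) *
          (A * ((c : ℕ).divisors.card * ((c : ℕ) : ℝ) ^ (11 / 12 : ℝ))) := by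
        rw [equidistributionError, norm_mul, Complex.norm_natCast_cpow_of_pos hc]
        gcongr
        exact (norm_unitPairSum_sub_le hr (hC s hs) (hD s hs) c).trans_eq (by ring)
    _ = A * ((c : ℕ).divisors.card *
          (((c : ℕ) : ℝ) ^ (2 - 4 * σ) * ((c : ℕ) : ℝ) ^ (11 / 12 : ℝ))) := by ring
    _ = _ := by
        rw [← Real.rpow_add (by positivity)]
        ring_nf

end HolomorphicFamily

/-! ### The leading factors -/

section LeadingFactors

open MeasureTheory Filter Topology

/-- The factor of the leading term that depends on `a / c`. -/
noncomputable def leadA (w s : ℂ) : ℝ → ℂ := cpowPair (-conj w) (1 - 2 * s) (1 - 2 * s)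

/-- The factor of the leading term that depends on `d / c`. -/
noncomputable def leadD (z s : ℂ) : ℝ → ℂ := cpowPair z (-(2 * s)) (2 - 2 * s)

variable {z w : ℂ} {r : ℝ} {U : Set ℂ}

lemma differentiable_cpowPair (hz : z.im ≠ 0) {α β : ℂ → ℂ} (hα : Differentiable ℂ α)
    (hβ : Differentiable ℂ β) (x : ℝ) : Differentiable ℂ fun s => cpowPair z (α s) (β s) x :=
  (hα.const_cpow (Or.inl (Complex.slitPlane_ne_zero (ofReal_add_mem_slitPlane hz x)))).mul
    (hβ.const_cpow (Or.inl (Complex.slitPlane_ne_zero (ofReal_add_conj_mem_slitPlane hz x))))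

lemma holomorphicDecayingC2_cpowPair (hz : 0 < z.im) (hr : 0 ≤ r) {α β : ℂ → ℂ}
    (hα : Differentiable ℂ α) (hβ : Differentiable ℂ β)
    (hαβ : ∀ s ∈ U, (α s + β s).re ≤ -r) :
    HolomorphicDecayingC2 U r fun s => cpowPair z (α s) (β s) where
  differentiableOn x := (differentiable_cpowPair hz.ne' hα hβ x).differentiableOn
  exists_decayingC2 K hKU hK := by
    obtain ⟨A, hA⟩ := hK.exists_bound_of_continuousOn hα.continuous.continuousOn
    obtain ⟨B, hB⟩ := hK.exists_bound_of_continuousOn hβ.continuous.continuousOn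
    obtain ⟨C, hC⟩ := exists_decayingC2_cpowPair hz hr (max A B)
    exact ⟨C, fun s hs => hC _ _ ((hA s hs).trans (le_max_left A B))
      ((hB s hs).trans (le_max_right A B)) (hαβ s (hKU hs))⟩

lemma holomorphicDecayingC2_leadA (hw : 0 < w.im) (hr : 0 ≤ r) (hU : ∀ s ∈ U, r ≤ 4 * s.re - 2) :
    HolomorphicDecayingC2 U r (leadA w) :=
  holomorphicDecayingC2_cpowPair (by simpa using hw) hr (by fun_prop) (by fun_prop)
    fun s hs => by simp; linarith [hU s hs]

lemma holomorphicDecayingC2_leadD (hz : 0 < z.im) (hr : 0 ≤ r) (hU : ∀ s ∈ U, r ≤ 4 * s.re - 2) :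
    HolomorphicDecayingC2 U r (leadD z) :=
  holomorphicDecayingC2_cpowPair hz hr (by fun_prop) (by fun_prop)
    fun s hs => by simp; linarith [hU s hs]

-- `leadD z 1 x = (x + z) ^ (-2)` is the derivative of `-(x + z)⁻¹`.
lemma integral_leadD_one (hz : 0 < z.im) : ∫ x, leadD z 1 x = 0 := by
  obtain ⟨C, hC⟩ := (holomorphicDecayingC2_leadD (U := {1}) (r := 2) hz (by norm_num)
    (by norm_num)).exists_decayingC2 {1} subset_rfl isCompact_singleton
  have hint : Integrable (leadD z 1) := by
    simpa using! (hC 1 rfl).integrable_iteratedDeriv one_lt_two (k := 0) (by norm_num)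
  have hne (x : ℝ) : (x : ℂ) + z ≠ 0 :=
    Complex.slitPlane_ne_zero (ofReal_add_mem_slitPlane hz.ne' x)
  have hderiv (x : ℝ) : HasDerivAt (fun x : ℝ => -((x : ℂ) + z)⁻¹) (leadD z 1 x) x := by
    convert! (((hasDerivAt_id (x : ℂ)).add_const z).inv (hne x)).neg.comp_ofReal using 1
    simp [leadD, cpowPair, Complex.cpow_neg, div_eq_mul_inv]
  have hlim (l : Filter ℝ) (hl : Tendsto (fun x : ℝ => |x|) l atTop) :
      Tendsto (fun x : ℝ => -((x : ℂ) + z)⁻¹) l (𝓝 0) := by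
    rw [← neg_zero]
    refine (tendsto_inv₀_cobounded.comp (tendsto_norm_atTop_iff_cobounded.1 ?_)).neg
    refine tendsto_atTop_mono (fun x => ?_) (tendsto_atTop_add_const_right l (-‖z‖) hl)
    have := norm_sub_le ((x : ℂ) + z) z
    rw [add_sub_cancel_right, Complex.norm_real, Real.norm_eq_abs] at this
    linarith
  rw [integral_of_hasDerivAt_of_tendsto hderiv hint (hlim _ tendsto_abs_atBot_atTop)
    (hlim _ tendsto_abs_atTop_atTop), sub_zero]

end LeadingFactors

section Continuation

/-- The series `∑ i, f i s` converges for `1 < re s` and its sum extends to a holomorphic function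
on `U`. -/
def HasContinuation {ι : Type*} (U : Set ℂ) (f : ι → ℂ → ℂ) : Prop :=
  ∃ F : ℂ → ℂ, DifferentiableOn ℂ F U ∧ ∀ s : ℂ, 1 < s.re → HasSum (fun i => f i s) (F s)

variable {ι : Type*} {U : Set ℂ}

lemma hasContinuation_of_summableLocallyUniformlyOn {f : ι → ℂ → ℂ} (hU : IsOpen U)
    (hU1 : {s : ℂ | 1 < s.re} ⊆ U) (hf : SummableLocallyUniformlyOn f U)
    (hdiff : ∀ i, DifferentiableOn ℂ (f i) U) : HasContinuation U f :=
  ⟨fun s => ∑' i, f i s,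
    hf.differentiableOn hU fun i _ hs => (hdiff i).differentiableAt (hU.mem_nhds hs),
    fun _ hs => (hf.summable (hU1 hs)).hasSum⟩

lemma HasContinuation.add {f g : ι → ℂ → ℂ} (hf : HasContinuation U f)
    (hg : HasContinuation U g) : HasContinuation U fun i s => f i s + g i s := by
  obtain ⟨F, hF, hFsum⟩ := hf
  obtain ⟨G, hG, hGsum⟩ := hg
  exact ⟨fun s => F s + G s, hF.add hG, fun s hs => (hFsum s hs).add (hGsum s hs)⟩

lemma HasContinuation.union {α : Type*} {f : α → ℂ → ℂ} {S T : Set α}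
    (hST : Disjoint S T) (hS : HasContinuation U fun i : S => f i)
    (hT : HasContinuation U fun i : T => f i) :
    HasContinuation U fun i : (S ∪ T : Set α) => f i := by
  obtain ⟨F, hF, hFsum⟩ := hS
  obtain ⟨G, hG, hGsum⟩ := hT
  exact ⟨fun s => F s + G s, hF.add hG, fun s hs =>
    HasSum.add_disjoint (f := fun i => f i s) hST (hFsum s hs) (hGsum s hs)⟩

-- The vanishing of `J` at `1` cancels the simple pole of `ζ(4s - 3)`.
lemma hasContinuation_mul_totient {N : ℕ} (hN : N ≠ 0) (hU : IsOpen U)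
    (hUre : U ⊆ {s | 3 / 4 < s.re}) (hU1 : 1 ∈ U) {I J : ℂ → ℂ} (hI : DifferentiableOn ℂ I U)
    (hJ : DifferentiableOn ℂ J U) (hJ1 : J 1 = 0) :
    HasContinuation U fun (c : Modulus N) s =>
      I s * J s * ((c : ℕ).totient * ((c : ℕ) : ℂ) ^ (2 - 4 * s)) := by
  refine ⟨fun s => I s * (dslope J 1 s *
    (DirichletCharacter.LFunctionTrivChar₁ 1 (4 * s - 3) / 4)) *
      LSeries (totientCoeff N) (4 * s - 2), ?_, fun s hs => ?_⟩
  · refine (hI.mul (((Complex.differentiableOn_dslope (hU.mem_nhds hU1)).2 hJ).mul ?_)).mul ?_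
    · exact (((DirichletCharacter.differentiable_LFunctionTrivChar₁ 1).comp
        (by fun_prop)).div_const 4).differentiableOn
    · refine (differentiableOn_lseries_totientCoeff hN).comp (by fun_prop) fun s hs => ?_
      have : 3 / 4 < s.re := hUre hs
      simp only [Set.mem_ofPred_eq, Complex.sub_re, Complex.mul_re, Complex.re_ofNat,
        Complex.im_ofNat]
      linarith
  · have hs1 : 4 * s - 3 ≠ 1 := by
      intro h
      rw [show s = 1 by linear_combination h / 4] at hs
      simp at hs
    have hsum := (hasSum_totient_mul_cpow hN (t := 4 * s - 2) (by simp; linarith)).mul_left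
      (I s * J s)
    have hslope : (s - 1) * dslope J 1 s = J s := by
      simpa [hJ1] using sub_smul_dslope J 1 s
    rw [neg_sub] at hsum
    convert! hsum using 1
    beta_reduce
    rw [lFunctionTrivChar₁_one_of_ne_one hs1, ← hslope, show 4 * s - 2 - 1 = 4 * s - 3 by ring]
    ring

variable {z w : ℂ} {N : ℕ}

-- The pole at `s = 1` disappears because `leadD z 1` has integral zero.
lemma hasContinuation_unitPairSum (hN : N ≠ 0) (hz : 0 < z.im) (hw : 0 < w.im) :
    HasContinuation {s | 47 / 48 < s.re} fun (c : Modulus N) s =>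
      ((c : ℕ) : ℂ) ^ (2 - 4 * s) * unitPairSum c (leadA w s) (leadD z s) := by
  have hU : IsOpen {s : ℂ | 47 / 48 < s.re} := Complex.isOpen_re_gt _
  have hr (s : ℂ) (hs : s ∈ {s : ℂ | 47 / 48 < s.re}) : 3 / 2 ≤ 4 * s.re - 2 := by
    linarith [show 47 / 48 < s.re from hs]
  have hA := holomorphicDecayingC2_leadA hw (by norm_num) hr
  have hD := holomorphicDecayingC2_leadD hz (by norm_num) hr
  have hAint := hA.differentiableOn_integral hU (by norm_num)
  have hDint := hD.differentiableOn_integral hU (by norm_num)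
  have herror : HasContinuation {s | 47 / 48 < s.re} fun (c : Modulus N) s =>
      equidistributionError (leadA w) (leadD z) c s :=
    hasContinuation_of_summableLocallyUniformlyOn hU
      (fun s (hs : 1 < s.re) => show 47 / 48 < s.re by linarith)
      (summableLocallyUniformlyOn_equidistributionError N (by norm_num) hA hD) fun c =>
      (differentiable_natCast_cpow c.2.2).differentiableOn.mul
        ((hA.differentiableOn_unitPairSum hU (by norm_num) hD c).sub
          ((hAint.const_mul _).mul hDint))
  have hmain := hasContinuation_mul_totient hN hU
    (fun s (hs : 47 / 48 < s.re) => show 3 / 4 < s.re by linarith) (by norm_num) hAint hDint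
    (integral_leadD_one hz)
  convert! herror.add hmain using 3
  rw [equidistributionError]
  ring

end Continuation

/-! ### The big cell -/

section BigCell

variable {N c : ℕ}

lemma apply_mul_apply_sub_eq_one (γ : SL(2, ℤ)) : γ 0 0 * γ 1 1 - γ 0 1 * γ 1 0 = 1 :=
  (Matrix.det_fin_two γ.1).symm.trans γ.2

lemma eq_of_apply_eq_of_apply_one_zero_ne_zero {γ δ : SL(2, ℤ)} (hc : γ 1 0 ≠ 0)
    (h10 : γ 1 0 = δ 1 0) (h00 : γ 0 0 = δ 0 0) (h11 : γ 1 1 = δ 1 1) : γ = δ := by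
  have h01 : γ 0 1 = δ 0 1 := mul_right_cancel₀ hc (by
    linear_combination (γ 1 1) * h00 + (δ 0 0) * h11 - (δ 0 1) * h10 +
      apply_mul_apply_sub_eq_one δ - apply_mul_apply_sub_eq_one γ)
  ext i j
  fin_cases i <;> fin_cases j <;> assumption

/-- The matrices of `Γ₀(N)` with nonzero lower left entry. -/
def bigCell (N : ℕ) : Set SL(2, ℤ) := {γ | γ ∈ CongruenceSubgroup.Gamma0 N ∧ γ 1 0 ≠ 0}

lemma natCast_dvd_residueLift_mul_residueLift_inv_sub_one [NeZero c] (u : (ZMod c)ˣ) (j k : ℤ) :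
    (c : ℤ) ∣ residueLift (u : ZMod c) j * residueLift ((u⁻¹ : (ZMod c)ˣ) : ZMod c) k - 1 := by
  rw [← ZMod.intCast_zmod_eq_zero_iff_dvd]
  simp

/-- The matrix of determinant one with lower row `ε * (c, d)` and upper left entry `ε * a`, where
`a` and `d` are the lifts of `u` and `u⁻¹` numbered `j` and `k`. -/
def cellMatrix [NeZero c] (ε : ℤˣ) (u : (ZMod c)ˣ) (j k : ℤ) : SL(2, ℤ) :=
  ⟨!![ε * residueLift (u : ZMod c) j,
      ε * ((residueLift (u : ZMod c) j * residueLift ((u⁻¹ : (ZMod c)ˣ) : ZMod c) k - 1) / c);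
      ε * c, ε * residueLift ((u⁻¹ : (ZMod c)ˣ) : ZMod c) k], by
    have hdvd := Int.ediv_mul_cancel (natCast_dvd_residueLift_mul_residueLift_inv_sub_one u j k)
    have hε : (ε : ℤ) * ε = 1 := Int.units_coe_mul_self ε
    rw [Matrix.det_fin_two_of]
    linear_combination hε - (ε : ℤ) * ε * hdvd⟩

section Entries

variable [NeZero c] (ε : ℤˣ) (u : (ZMod c)ˣ) (j k : ℤ)

lemma cellMatrix_apply_one_zero : cellMatrix ε u j k 1 0 = ε * c := rfl

lemma cellMatrix_apply_zero_zero : cellMatrix ε u j k 0 0 = ε * residueLift (u : ZMod c) j := rfl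

lemma cellMatrix_apply_one_one :
    cellMatrix ε u j k 1 1 = ε * residueLift ((u⁻¹ : (ZMod c)ˣ) : ZMod c) k := rfl

lemma natAbs_cellMatrix_apply_one_zero : (cellMatrix ε u j k 1 0).natAbs = c := by
  rw [cellMatrix_apply_one_zero, Int.natAbs_mul, Int.units_natAbs, one_mul, Int.natAbs_natCast]

lemma cellMatrix_apply_zero_zero_div :
    (cellMatrix ε u j k 0 0 / cellMatrix ε u j k 1 0 : ℝ) = residueLift (u : ZMod c) j / c := by
  rw [cellMatrix_apply_zero_zero, cellMatrix_apply_one_zero]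
  push_cast
  exact mul_div_mul_left _ _ (by exact_mod_cast ε.ne_zero)

lemma cellMatrix_apply_one_one_div :
    (cellMatrix ε u j k 1 1 / cellMatrix ε u j k 1 0 : ℝ) =
      residueLift ((u⁻¹ : (ZMod c)ˣ) : ZMod c) k / c := by
  rw [cellMatrix_apply_one_one, cellMatrix_apply_one_zero]
  push_cast
  exact mul_div_mul_left _ _ (by exact_mod_cast ε.ne_zero)

end Entries

lemma cellMatrix_mem_bigCell (c : Modulus N) (ε : ℤˣ) (u : (ZMod c)ˣ) (j k : ℤ) :
    cellMatrix ε u j k ∈ bigCell N := by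
  constructor
  · rw [CongruenceSubgroup.Gamma0_mem, cellMatrix_apply_one_zero,
      ZMod.intCast_zmod_eq_zero_iff_dvd]
    exact (Int.natCast_dvd_natCast.2 c.2.1).mul_left _
  · rw [← Int.natAbs_ne_zero, natAbs_cellMatrix_apply_one_zero]
    exact c.2.2

lemma eq_of_cellMatrix_eq [NeZero c] {ε ε' : ℤˣ} {u u' : (ZMod c)ˣ} {j j' k k' : ℤ}
    (h : cellMatrix ε u j k = cellMatrix ε' u' j' k') :
    ε = ε' ∧ u = u' ∧ j = j' ∧ k = k' := by
  have hc : (c : ℤ) ≠ 0 := Nat.cast_ne_zero.2 (NeZero.ne c)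
  obtain rfl : ε = ε' := Units.ext (mul_right_cancel₀ hc (congrArg (fun γ => γ 1 0) h))
  have ha := mul_left_cancel₀ ε.ne_zero (congrArg (fun γ => γ 0 0) h)
  have hd := mul_left_cancel₀ ε.ne_zero (congrArg (fun γ => γ 1 1) h)
  obtain rfl : u = u' := Units.ext (by simpa using congrArg (Int.cast : ℤ → ZMod c) ha)
  exact ⟨rfl, rfl, residueLift_injective _ ha, residueLift_injective _ hd⟩

lemma exists_cellMatrix_eq [NeZero c] {γ : SL(2, ℤ)} (hγ : (γ 1 0).natAbs = c) :
    ∃ (ε : ℤˣ) (u : (ZMod c)ˣ) (j k : ℤ), cellMatrix ε u j k = γ := by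
  obtain ⟨ε, hε⟩ : ∃ ε : ℤˣ, γ 1 0 = ε * c := by
    rcases Int.natAbs_eq (γ 1 0) with h | h
    · exact ⟨1, by simpa [hγ] using h⟩
    · exact ⟨-1, by simpa [hγ] using h⟩
  have hεε : (ε : ℤ) * ε = 1 := Int.units_coe_mul_self ε
  have hmul : (ε * γ 0 0) * (ε * γ 1 1) = 1 + ε * γ 0 1 * c := by
    linear_combination (γ 0 0 * γ 1 1) * hεε + apply_mul_apply_sub_eq_one γ + γ 0 1 * hε
  have hinv : ((ε * γ 0 0 : ℤ) : ZMod c) * ((ε * γ 1 1 : ℤ) : ZMod c) = 1 := by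
    rw [← Int.cast_mul, hmul]
    simp
  obtain ⟨j, hj⟩ := exists_residueLift_eq (c := c) (ε * γ 0 0)
  obtain ⟨k, hk⟩ := exists_residueLift_eq (c := c) (ε * γ 1 1)
  refine ⟨ε, Units.mkOfMulEqOne _ _ hinv, j, k,
    (eq_of_apply_eq_of_apply_one_zero_ne_zero ?_ hε ?_ ?_).symm⟩
  · exact Int.natAbs_ne_zero.1 (hγ ▸ NeZero.ne c)
  · exact (congrArg ((ε : ℤ) * ·) hj |>.trans (by linear_combination γ 0 0 * hεε)).symm
  · exact (congrArg ((ε : ℤ) * ·) hk |>.trans (by linear_combination γ 1 1 * hεε)).symm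

/-- The parametrization `cellMatrix` of the big cell, in the order: sign, lower left entry, unit,
lifts. -/
noncomputable def bigCellEquiv (N : ℕ) :
    (ℤˣ × Σ c : Modulus N, (ZMod c)ˣ × ℤ × ℤ) ≃ bigCell N :=
  Equiv.ofBijective
    (fun ⟨ε, c, u, j, k⟩ => ⟨cellMatrix ε u j k, cellMatrix_mem_bigCell c ε u j k⟩) <| by
    constructor
    · rintro ⟨ε, c, u, j, k⟩ ⟨ε', c', u', j', k'⟩ h
      have h : cellMatrix ε u j k = cellMatrix ε' u' j' k' := congrArg Subtype.val h
      obtain rfl : c = c' := Subtype.ext <| by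
        rw [← natAbs_cellMatrix_apply_one_zero ε u j k, h, natAbs_cellMatrix_apply_one_zero]
      obtain ⟨rfl, rfl, rfl, rfl⟩ := eq_of_cellMatrix_eq h
      rfl
    · rintro ⟨γ, hγ, hc⟩
      rw [CongruenceSubgroup.Gamma0_mem, ZMod.intCast_zmod_eq_zero_iff_dvd] at hγ
      obtain ⟨c, hcγ⟩ : ∃ c : Modulus N, (γ 1 0).natAbs = c :=
        ⟨⟨_, Int.natCast_dvd.1 hγ, Int.natAbs_ne_zero.2 hc⟩, rfl⟩
      obtain ⟨ε, u, j, k, h⟩ := exists_cellMatrix_eq hcγ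
      exact ⟨⟨ε, c, u, j, k⟩, Subtype.ext h⟩

end BigCell

/-! ### Comparison of the summands with the leading terms -/

section HeckeFactor

variable {ζ : ℂ}

/-- The function `conj ζ / |ζ| ^ (2 s)`, of which `cauchyTerm` is a product of two values. -/
noncomputable def heckeFactor (s ζ : ℂ) : ℂ := conj ζ / (‖ζ‖ : ℂ) ^ (2 * s)

lemma cauchyTerm_eq_heckeFactor_mul (γ : SL(2, ℤ)) (z w s : ℂ) :
    cauchyTerm γ z w s = heckeFactor s (mu γ z (-w)) * heckeFactor s (mu γ z (-conj w)) :=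
  mul_div_mul_comm ..

lemma heckeFactor_mul (s ζ ξ : ℂ) : heckeFactor s (ζ * ξ) = heckeFactor s ζ * heckeFactor s ξ := by
  unfold heckeFactor
  rw [map_mul, norm_mul, Complex.ofReal_mul,
    Complex.mul_cpow_ofReal_nonneg (norm_nonneg _) (norm_nonneg _), mul_div_mul_comm]

lemma heckeFactor_eq_exp (hζ : ζ ≠ 0) (s : ℂ) :
    heckeFactor s ζ = conj ζ * Complex.exp (-(2 * s) * (Real.log ‖ζ‖ : ℝ)) := by
  have hpos : 0 < ‖ζ‖ := norm_pos_iff.2 hζ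
  rw [heckeFactor, Complex.cpow_def_of_ne_zero (Complex.ofReal_ne_zero.2 hpos.ne'),
    ← Complex.ofReal_log hpos.le, div_eq_mul_inv, ← Complex.exp_neg]
  congr 2
  ring

lemma differentiable_heckeFactor (hζ : ζ ≠ 0) : Differentiable ℂ fun s => heckeFactor s ζ := by
  simp only [heckeFactor_eq_exp hζ]
  fun_prop

lemma norm_heckeFactor (hζ : ζ ≠ 0) (s : ℂ) : ‖heckeFactor s ζ‖ = ‖ζ‖ ^ (1 - 2 * s.re) := by
  have hpos : 0 < ‖ζ‖ := norm_pos_iff.2 hζ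
  rw [heckeFactor, norm_div, Complex.norm_conj, Complex.norm_cpow_eq_rpow_re_of_pos hpos,
    Real.rpow_sub hpos, Real.rpow_one]
  simp

lemma heckeFactor_of_mem_slitPlane (hζ : ζ ∈ Complex.slitPlane) (s : ℂ) :
    heckeFactor s ζ = ζ ^ (-s) * conj ζ ^ (1 - s) := by
  have hne : ζ ≠ 0 := Complex.slitPlane_ne_zero hζ
  have hne' : conj ζ ≠ 0 := by simpa using hne
  have hlog : Complex.log ζ + Complex.log (conj ζ) = 2 * (Real.log ‖ζ‖ : ℝ) := by
    rw [Complex.log_conj _ (Complex.slitPlane_arg_ne_pi hζ), Complex.add_conj, Complex.log_re]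
    push_cast
    ring
  rw [heckeFactor_eq_exp hne, Complex.cpow_sub _ _ hne', Complex.cpow_one,
    Complex.cpow_def_of_ne_zero hne, Complex.cpow_def_of_ne_zero hne', mul_div_assoc',
    mul_comm (Complex.exp _), mul_div_assoc, ← Complex.exp_sub]
  congr 2
  linear_combination s * hlog

lemma heckeFactor_intCast_mul_self (s : ℂ) {c : ℤ} (hc : c ≠ 0) :
    heckeFactor s c * heckeFactor s c = (c.natAbs : ℂ) ^ (2 - 4 * s) := by
  have hne : (c.natAbs : ℂ) ≠ 0 := Nat.cast_ne_zero.2 (Int.natAbs_ne_zero.2 hc)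
  have hnorm : ‖(c : ℂ)‖ = (c.natAbs : ℝ) := by
    rw [Complex.norm_intCast, Nat.cast_natAbs, Int.cast_abs]
  have hsq : (c : ℂ) * c = (c.natAbs : ℂ) ^ (2 : ℂ) := by
    rw [Complex.cpow_ofNat, ← sq]
    simpa only [Int.cast_pow, Int.cast_natCast] using
      congrArg (Int.cast : ℤ → ℂ) (Int.natAbs_sq c).symm
  rw [heckeFactor, hnorm, map_intCast, div_mul_div_comm, hsq, Complex.ofReal_natCast,
    ← Complex.cpow_add _ _ hne, ← Complex.cpow_sub _ _ hne]
  congr 1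
  ring

lemma contDiffAt_heckeFactor (hζ : ζ ≠ 0) (s : ℂ) :
    ContDiffAt ℝ 1 (fun p : ℂ × ℂ => heckeFactor p.1 p.2) (s, ζ) := by
  have hexp : (fun p : ℂ × ℂ => heckeFactor p.1 p.2) =ᶠ[nhds (s, ζ)]
      fun p => conj p.2 * Complex.exp (-(2 * p.1) * (Real.log ‖p.2‖ : ℝ)) := by
    filter_upwards [continuousAt_snd.eventually_ne hζ] with p hp
    exact heckeFactor_eq_exp hp p.1
  refine ContDiffAt.congr_of_eventuallyEq ?_ hexp
  have hlog : ContDiffAt ℝ 1 (fun p : ℂ × ℂ => Real.log ‖p.2‖) (s, ζ) :=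
    (contDiffAt_snd.norm ℝ hζ).log (norm_ne_zero_iff.2 hζ)
  exact (Complex.conjCLE.contDiff.contDiffAt.comp _ contDiffAt_snd).mul
    ((contDiffAt_const.mul contDiffAt_fst).neg.mul
      (Complex.ofRealCLM.contDiff.contDiffAt.comp _ hlog)).cexp

lemma exists_norm_heckeFactor_mul_sub_one_le {K : Set ℂ} (hK : IsCompact K) : ∃ C : NNReal,
    ∀ s ∈ K, ∀ ε ε' : ℂ, ‖ε‖ ≤ 1 / 2 → ‖ε'‖ ≤ 1 / 2 →
      ‖heckeFactor s (1 - ε) * heckeFactor s (1 - ε') - 1‖ ≤ C * max ‖ε‖ ‖ε'‖ := by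
  obtain ⟨R, hKR⟩ := hK.isBounded.subset_closedBall 0
  have hne {ε : ℂ} (hε : ε ∈ Metric.closedBall 0 (1 / 2)) : 1 - ε ≠ 0 := by
    intro h
    rw [← sub_eq_zero.1 h, mem_closedBall_zero_iff, norm_one] at hε
    norm_num at hε
  let D : Set (ℂ × ℂ × ℂ) :=
    Metric.closedBall 0 R ×ˢ Metric.closedBall 0 (1 / 2) ×ˢ Metric.closedBall 0 (1 / 2)
  have hD : IsCompact D := (isCompact_closedBall _ _).prod
    ((isCompact_closedBall _ _).prod (isCompact_closedBall _ _))
  have hDconv : Convex ℝ D := (convex_closedBall _ _).prod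
    ((convex_closedBall _ _).prod (convex_closedBall _ _))
  have hcontDiff : ContDiffOn ℝ 1
      (fun q : ℂ × ℂ × ℂ => heckeFactor q.1 (1 - q.2.1) * heckeFactor q.1 (1 - q.2.2)) D := by
    rintro ⟨s, ε, ε'⟩ ⟨-, hε, hε'⟩
    refine (ContDiffAt.mul ?_ ?_).contDiffWithinAt
    · exact (contDiffAt_heckeFactor (hne hε) s).comp (f := fun q : ℂ × ℂ × ℂ => (q.1, 1 - q.2.1))
        (s, ε, ε') (by fun_prop)
    · exact (contDiffAt_heckeFactor (hne hε') s).comp (f := fun q : ℂ × ℂ × ℂ => (q.1, 1 - q.2.2))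
        (s, ε, ε') (by fun_prop)
  obtain ⟨C, hC⟩ := hcontDiff.exists_lipschitzOnWith one_ne_zero hDconv hD
  refine ⟨C, fun s hs ε ε' hε hε' => ?_⟩
  have hlip := hC.norm_sub_le
    (x := (s, ε, ε')) ⟨hKR hs, mem_closedBall_zero_iff.2 hε, mem_closedBall_zero_iff.2 hε'⟩
    (y := (s, 0, 0)) ⟨hKR hs, Metric.mem_closedBall_self (by norm_num),
      Metric.mem_closedBall_self (by norm_num)⟩
  simpa [heckeFactor, Prod.norm_def] using hlip

end HeckeFactor

section LeadTerm

variable {γ : SL(2, ℤ)} {z w : ℂ}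

/-- The product `(a - c v) (c z + d)` for `γ = (a b; c d)`, which equals `c μ_γ(z, -v) + 1`. -/
def cellProduct (γ : SL(2, ℤ)) (z v : ℂ) : ℂ := (γ 0 0 - γ 1 0 * v) * (γ 1 0 * z + γ 1 1)

lemma apply_one_zero_mul_mu_neg (γ : SL(2, ℤ)) (z v : ℂ) :
    γ 1 0 * mu γ z (-v) = cellProduct γ z v - 1 := by
  have hdet : (γ 0 0 * γ 1 1 - γ 0 1 * γ 1 0 : ℂ) = 1 :=
    mod_cast congrArg (Int.cast : ℤ → ℂ) (apply_mul_apply_sub_eq_one γ)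
  rw [mu, cellProduct]
  linear_combination -hdet

/-- The leading term of `cauchyTerm` on the big cell, obtained by replacing `c μ_γ(z, -v)` by
`cellProduct γ z v`. -/
noncomputable def leadTerm (γ : SL(2, ℤ)) (z w s : ℂ) : ℂ :=
  ((γ 1 0).natAbs : ℂ) ^ (2 - 4 * s) *
    (leadA w s (γ 0 0 / γ 1 0) * leadD z s (γ 1 1 / γ 1 0))

lemma leadA_eq_heckeFactor_mul (hw : w.im ≠ 0) (s : ℂ) (x : ℝ) :
    leadA w s x = heckeFactor s (x - w) * heckeFactor s (x - conj w) := by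
  have hmem := ofReal_add_mem_slitPlane (z := -w) (by simpa using hw) x
  have hmem' := ofReal_add_conj_mem_slitPlane (z := -w) (by simpa using hw) x
  rw [map_neg] at hmem'
  rw [← sub_eq_add_neg] at hmem hmem'
  rw [heckeFactor_of_mem_slitPlane hmem, heckeFactor_of_mem_slitPlane hmem', leadA, cpowPair]
  simp only [map_neg, map_sub, Complex.conj_conj, Complex.conj_ofReal, ← sub_eq_add_neg]
  rw [show 1 - 2 * s = -s + (1 - s) by ring,
    Complex.cpow_add _ _ (Complex.slitPlane_ne_zero hmem),
    Complex.cpow_add _ _ (Complex.slitPlane_ne_zero hmem')]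
  ring

lemma leadD_eq_heckeFactor_mul (hz : z.im ≠ 0) (s : ℂ) (x : ℝ) :
    leadD z s x = heckeFactor s (x + z) * heckeFactor s (x + z) := by
  have hmem := ofReal_add_mem_slitPlane hz x
  have hmem' := ofReal_add_conj_mem_slitPlane hz x
  rw [heckeFactor_of_mem_slitPlane hmem, leadD, cpowPair, map_add, Complex.conj_ofReal,
    show -(2 * s) = -s + -s by ring, show 2 - 2 * s = (1 - s) + (1 - s) by ring,
    Complex.cpow_add _ _ (Complex.slitPlane_ne_zero hmem),
    Complex.cpow_add _ _ (Complex.slitPlane_ne_zero hmem')]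
  ring

lemma leadTerm_eq_heckeFactor_mul (hz : z.im ≠ 0) (hw : w.im ≠ 0) (hc : γ 1 0 ≠ 0) (s : ℂ) :
    leadTerm γ z w s = heckeFactor s (cellProduct γ z w / γ 1 0) *
      heckeFactor s (cellProduct γ z (conj w) / γ 1 0) := by
  have hcC : (γ 1 0 : ℂ) ≠ 0 := Int.cast_ne_zero.2 hc
  have hdiv (v : ℂ) : cellProduct γ z v / γ 1 0 =
      γ 1 0 * (((γ 0 0 / γ 1 0 : ℝ) : ℂ) - v) * (((γ 1 1 / γ 1 0 : ℝ) : ℂ) + z) := by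
    rw [cellProduct]
    push_cast
    field_simp
    ring
  rw [hdiv, hdiv, leadTerm, ← heckeFactor_intCast_mul_self s hc, leadA_eq_heckeFactor_mul hw,
    leadD_eq_heckeFactor_mul hz]
  simp only [heckeFactor_mul]
  ring

lemma cauchyTerm_eq_leadTerm_mul (hz : z.im ≠ 0) (hw : w.im ≠ 0) (hc : γ 1 0 ≠ 0)
    (hm : cellProduct γ z w ≠ 0) (hm' : cellProduct γ z (conj w) ≠ 0) (s : ℂ) :
    cauchyTerm γ z w s = leadTerm γ z w s * (heckeFactor s (1 - (cellProduct γ z w)⁻¹) *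
      heckeFactor s (1 - (cellProduct γ z (conj w))⁻¹)) := by
  have hcC : (γ 1 0 : ℂ) ≠ 0 := Int.cast_ne_zero.2 hc
  have hmu {v : ℂ} (hv : cellProduct γ z v ≠ 0) :
      mu γ z (-v) = cellProduct γ z v / γ 1 0 * (1 - (cellProduct γ z v)⁻¹) := by
    rw [div_mul_eq_mul_div, mul_sub, mul_inv_cancel₀ hv, mul_one, eq_div_iff hcC, mul_comm]
    exact apply_one_zero_mul_mu_neg γ z v
  rw [cauchyTerm_eq_heckeFactor_mul, hmu hm, hmu hm', leadTerm_eq_heckeFactor_mul hz hw hc,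
    heckeFactor_mul, heckeFactor_mul]
  ring

end LeadTerm

/-! ### The sum of the leading terms -/

section LeadingSum

lemma hasSum_prod_of_fintype {κ ι M : Type*} [Fintype κ] [AddCommMonoid M] [TopologicalSpace M]
    [ContinuousAdd M] {f : κ → ι → M} {a : κ → M} (hf : ∀ k, HasSum (f k) (a k)) :
    HasSum (fun x : κ × ι => f x.1 x.2) (∑ k, a k) := by
  classical
  have hslice (k : κ) : HasSum (fun x : κ × ι => if x.1 = k then f x.1 x.2 else 0) (a k) := by
    refine ((Prod.mk_right_injective k).hasSum_iff fun x hx => if_neg fun h => hx ⟨x.2, ?_⟩).1 ?_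
    · exact Prod.ext h.symm rfl
    · simpa [Function.comp_def] using hf k
  simpa using hasSum_sum fun k (_ : k ∈ Finset.univ) => hslice k

lemma DecayingC2.hasSum_mul_residueLift {r C D : ℝ} (hr : 1 < r) {f g : ℝ → ℂ}
    (hf : DecayingC2 r C f) (hg : DecayingC2 r D g) (c : ℕ) [NeZero c] :
    HasSum (fun x : (ZMod c)ˣ × ℤ × ℤ => f (residueLift (x.1 : ZMod c) x.2.1 / c) *
      g (residueLift ((x.1⁻¹ : (ZMod c)ˣ) : ZMod c) x.2.2 / c)) (unitPairSum c f g) := by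
  have hsummable {h : ℝ → ℂ} {E : ℝ} (hh : DecayingC2 r E h) (a : ZMod c) :
      Summable fun j : ℤ => ‖h (residueLift a j / c)‖ := by
    simpa only [residueLift_div] using (hh.summable_add_intCast hr _).norm
  have hunit (u : (ZMod c)ˣ) : HasSum (fun x : ℤ × ℤ => f (residueLift (u : ZMod c) x.1 / c) *
        g (residueLift ((u⁻¹ : (ZMod c)ˣ) : ZMod c) x.2 / c))
      ((∑' j : ℤ, f (residueLift (u : ZMod c) j / c)) *
        ∑' k : ℤ, g (residueLift ((u⁻¹ : (ZMod c)ˣ) : ZMod c) k / c)) := by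
    rw [tsum_mul_tsum_of_summable_norm (hsummable hf _) (hsummable hg _)]
    exact (summable_mul_of_summable_norm (hsummable hf _) (hsummable hg _)).hasSum
  exact hasSum_prod_of_fintype hunit

variable {N : ℕ} {r ρ : ℝ}

lemma summable_modulus_rpow_mul (hρ : 2 < ρ) {v : ℤ × ℤ → ℝ} (hv : Summable v)
    (hv0 : ∀ x, 0 ≤ v x) : Summable fun x : Σ c : Modulus N, (ZMod c)ˣ × ℤ × ℤ =>
      ((x.1 : ℕ) : ℝ) ^ (-ρ) * v x.2.2 := by
  have hfiber (c : Modulus N) : HasSum (fun y : (ZMod c)ˣ × ℤ × ℤ => ((c : ℕ) : ℝ) ^ (-ρ) * v y.2)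
      (((c : ℕ) : ℝ) ^ (-ρ) * ((c : ℕ).totient * ∑' x, v x)) := by
    simpa [ZMod.card_units_eq_totient] using
      (hasSum_prod_of_fintype fun _ : (ZMod c)ˣ => hv.hasSum).mul_left (((c : ℕ) : ℝ) ^ (-ρ))
  refine (summable_sigma_of_nonneg fun x => mul_nonneg (by positivity) (hv0 _)).2
    ⟨fun c => (hfiber c).summable, ?_⟩
  simp only [(hfiber _).tsum_eq, ← mul_assoc]
  refine .mul_right _ (.of_nonneg_of_le (fun c => by positivity) (fun c => ?_)
    ((Real.summable_nat_rpow (p := 1 - ρ).2 (by linarith)).subtype _))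
  have hc : (0 : ℝ) < (c : ℕ) := Nat.cast_pos.2 (NeZero.pos _)
  calc ((c : ℕ) : ℝ) ^ (-ρ) * (c : ℕ).totient ≤ ((c : ℕ) : ℝ) ^ (-ρ) * (c : ℕ) := by
        gcongr
        exact Nat.totient_le _
    _ = ((c : ℕ) : ℝ) ^ (1 - ρ) := by
        rw [← Real.rpow_add_one hc.ne', neg_add_eq_sub]

/-- The weight `|c| ^ (-ρ) (1 + |a / c|) ^ (-r) (1 + |d / c|) ^ (-r)` dominating the summands on the
big cell. -/
noncomputable def cellWeight (r ρ : ℝ) (γ : SL(2, ℤ)) : ℝ :=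
  ((γ 1 0).natAbs : ℝ) ^ (-ρ) * (decay r (γ 0 0 / γ 1 0) * decay r (γ 1 1 / γ 1 0))

lemma cellWeight_nonneg (r ρ : ℝ) (γ : SL(2, ℤ)) : 0 ≤ cellWeight r ρ γ :=
  mul_nonneg (by positivity) (mul_nonneg (decay_nonneg _ _) (decay_nonneg _ _))

lemma cellWeight_cellMatrix_le {c : ℕ} [NeZero c] (hr : 0 ≤ r) (ρ : ℝ) (ε : ℤˣ) (u : (ZMod c)ˣ)
    (j k : ℤ) : cellWeight r ρ (cellMatrix ε u j k) ≤
      (c : ℝ) ^ (-ρ) * ((2 ^ r * decay r j) * (2 ^ r * decay r k)) := by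
  rw [cellWeight, natAbs_cellMatrix_apply_one_zero, cellMatrix_apply_zero_zero_div,
    cellMatrix_apply_one_one_div]
  exact mul_le_mul_of_nonneg_left (mul_le_mul (decay_residueLift_div_le hr _ _)
    (decay_residueLift_div_le hr _ _) (decay_nonneg _ _)
    (mul_nonneg (by positivity) (decay_nonneg _ _))) (by positivity)

lemma summable_cellWeight (hr : 1 < r) (hρ : 2 < ρ) :
    Summable fun γ : bigCell N => cellWeight r ρ γ := by
  have hnonneg (j : ℤ) : 0 ≤ 2 ^ r * decay r j := mul_nonneg (by positivity) (decay_nonneg _ _)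
  have hdecay := (summable_decay_int hr).mul_left (2 ^ r)
  have hsigma := summable_modulus_rpow_mul (N := N) hρ
    (hdecay.mul_of_nonneg hdecay hnonneg hnonneg) fun x => mul_nonneg (hnonneg _) (hnonneg _)
  refine (bigCellEquiv N).summable_iff.1 (.of_nonneg_of_le (fun _ => cellWeight_nonneg _ _ _)
    (fun x => ?_) (hasSum_prod_of_fintype fun _ : ℤˣ => hsigma.hasSum).summable)
  obtain ⟨ε, c, u, j, k⟩ := x
  exact cellWeight_cellMatrix_le (by linarith) ρ ε u j k

variable {z w s : ℂ}

lemma norm_leadTerm_le {C D : ℝ} (hA : DecayingC2 r C (leadA w s))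
    (hD : DecayingC2 r D (leadD z s)) (hρ : ρ ≤ 4 * s.re - 2) {γ : SL(2, ℤ)} (hc : γ 1 0 ≠ 0) :
    ‖leadTerm γ z w s‖ ≤ C * D * cellWeight r ρ γ := by
  have hpos : 0 < (γ 1 0).natAbs := Int.natAbs_pos.2 hc
  have hone : (1 : ℝ) ≤ (γ 1 0).natAbs := Nat.one_le_cast.2 hpos
  have hre : (2 - 4 * s).re ≤ -ρ := by
    simp
    linarith
  rw [leadTerm, norm_mul, norm_mul, Complex.norm_natCast_cpow_of_pos hpos, cellWeight]
  calc _ ≤ ((γ 1 0).natAbs : ℝ) ^ (-ρ) *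
        ((C * decay r (γ 0 0 / γ 1 0)) * (D * decay r (γ 1 1 / γ 1 0))) := by
        have := mul_nonneg hA.nonneg (decay_nonneg r (γ 0 0 / γ 1 0))
        gcongr
        exacts [hA.norm_le _, hD.norm_le _]
    _ = _ := by ring

lemma leadTerm_cellMatrix {c : ℕ} [NeZero c] (ε : ℤˣ) (u : (ZMod c)ˣ) (j k : ℤ) (z w s : ℂ) :
    leadTerm (cellMatrix ε u j k) z w s = (c : ℂ) ^ (2 - 4 * s) *
      (leadA w s (residueLift (u : ZMod c) j / c) *
        leadD z s (residueLift ((u⁻¹ : (ZMod c)ˣ) : ZMod c) k / c)) := by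
  rw [leadTerm, natAbs_cellMatrix_apply_one_zero, cellMatrix_apply_zero_zero_div,
    cellMatrix_apply_one_one_div]

lemma hasSum_leadTerm {M : ℂ} {C D : ℝ} (hr : 1 < r) (hs : 1 < s.re)
    (hA : DecayingC2 r C (leadA w s)) (hD : DecayingC2 r D (leadD z s))
    (hM : HasSum (fun c : Modulus N =>
      ((c : ℕ) : ℂ) ^ (2 - 4 * s) * unitPairSum c (leadA w s) (leadD z s)) M) :
    HasSum (fun γ : bigCell N => leadTerm γ z w s) (2 * M) := by
  have hsummable : Summable fun γ : bigCell N => leadTerm γ z w s :=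
    .of_norm_bounded ((summable_cellWeight hr (ρ := 4 * s.re - 2) (by linarith)).mul_left (C * D))
      fun γ => norm_leadTerm_le hA hD le_rfl γ.2.2
  have hsigma (ε : ℤˣ) : HasSum (fun x : Σ c : Modulus N, (ZMod c)ˣ × ℤ × ℤ =>
      leadTerm (bigCellEquiv N (ε, x)) z w s) M := by
    have hsum := (hsummable.comp_injective
      ((bigCellEquiv N).injective.comp (Prod.mk_right_injective ε))).hasSum
    have hfiber (c : Modulus N) :=
      (hA.hasSum_mul_residueLift hr hD c).mul_left (((c : ℕ) : ℂ) ^ (2 - 4 * s))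
    have := hsum.sigma fun c => (hfiber c).congr_fun fun y => leadTerm_cellMatrix ..
    exact hM.unique this ▸ hsum
  refine (bigCellEquiv N).hasSum_iff.1 ?_
  simpa using! hasSum_prod_of_fintype hsigma

lemma hasContinuation_leadTerm (hN : N ≠ 0) (hz : 0 < z.im) (hw : 0 < w.im) :
    HasContinuation {s | 47 / 48 < s.re} fun (γ : bigCell N) s => leadTerm γ z w s := by
  obtain ⟨M, hM, hMsum⟩ := hasContinuation_unitPairSum hN hz hw
  refine ⟨fun s => 2 * M s, hM.const_mul 2, fun s hs => ?_⟩
  have hr (t : ℂ) (ht : t ∈ ({s} : Set ℂ)) : 2 ≤ 4 * t.re - 2 := by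
    rw [Set.mem_singleton_iff.1 ht]
    linarith
  obtain ⟨C, hA⟩ := (holomorphicDecayingC2_leadA hw zero_le_two hr).exists_decayingC2 {s}
    subset_rfl isCompact_singleton
  obtain ⟨D, hD⟩ := (holomorphicDecayingC2_leadD hz zero_le_two hr).exists_decayingC2 {s}
    subset_rfl isCompact_singleton
  exact hasSum_leadTerm one_lt_two hs (hA s rfl) (hD s rfl) (hMsum s hs)

end LeadingSum

/-! ### Local uniform convergence of the remaining terms -/

section BigCellRemainder

open Filter EisensteinSeries

variable {N : ℕ} {γ : SL(2, ℤ)} {z w : ℍ}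

lemma norm_cellProduct_conj (γ : SL(2, ℤ)) (z v : ℂ) :
    ‖cellProduct γ z (conj v)‖ = ‖cellProduct γ z v‖ := by
  have h : (γ 0 0 - γ 1 0 * conj v : ℂ) = conj (γ 0 0 - γ 1 0 * v : ℂ) := by simp
  rw [cellProduct, cellProduct, norm_mul, norm_mul, h, Complex.norm_conj]

lemma r_mul_norm_mul_r_mul_norm_le_norm_cellProduct (hc : γ 1 0 ≠ 0) (z w : ℍ) :
    r w * ‖![γ 1 0, -γ 0 0]‖ * (r z * ‖![γ 1 0, γ 1 1]‖) ≤ ‖cellProduct γ z w‖ := by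
  have hne (n : ℤ) : ![γ 1 0, n] ≠ 0 := fun h => hc (congrFun h 0)
  have hw := r_mul_max_le w (hne (-γ 0 0))
  have hz := r_mul_max_le z (hne (γ 1 1))
  have h : (γ 0 0 - γ 1 0 * w : ℂ) = -(γ 1 0 * w + (-γ 0 0 : ℤ)) := by
    push_cast
    ring
  rw [cellProduct, norm_mul, h, norm_neg]
  exact mul_le_mul hw hz (mul_nonneg (r_pos z).le (norm_nonneg _)) (norm_nonneg _)

lemma r_mul_sq_le_norm_cellProduct (hc : γ 1 0 ≠ 0) (z w : ℍ) :
    r w * r z * (γ 1 0).natAbs ^ 2 ≤ ‖cellProduct γ z w‖ := by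
  have hnorm (n : ℤ) : ((γ 1 0).natAbs : ℝ) ≤ ‖![γ 1 0, n]‖ := by
    simpa [Int.norm_eq_abs] using norm_le_pi_norm ![γ 1 0, n] 0
  calc r w * r z * (γ 1 0).natAbs ^ 2
      = r w * (γ 1 0).natAbs * (r z * (γ 1 0).natAbs) := by ring
    _ ≤ r w * ‖![γ 1 0, -γ 0 0]‖ * (r z * ‖![γ 1 0, γ 1 1]‖) := by
        have := (r_pos w).le
        have := (r_pos z).le
        gcongr <;> exact hnorm _
    _ ≤ _ := r_mul_norm_mul_r_mul_norm_le_norm_cellProduct hc z w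

lemma r_mul_norm_le_norm_cellProduct (hc : γ 1 0 ≠ 0) (z w : ℍ) :
    r w * r z * ‖(γ 1 0, γ 0 0, γ 1 1)‖ ≤ ‖cellProduct γ z w‖ := by
  have hle (x : Fin 2 → ℤ) (hx : x 0 = γ 1 0) : ‖γ 1 0‖ ≤ ‖x‖ ∧ ‖x 1‖ ≤ ‖x‖ ∧ 1 ≤ ‖x‖ := by
    have h0 := hx ▸ norm_le_pi_norm x 0
    refine ⟨h0, norm_le_pi_norm x 1, le_trans ?_ h0⟩
    rw [Int.norm_eq_abs]
    exact_mod_cast Int.one_le_abs hc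
  obtain ⟨hc', ha, hone⟩ := hle ![γ 1 0, -γ 0 0] rfl
  obtain ⟨-, hd, hone'⟩ := hle ![γ 1 0, γ 1 1] rfl
  have hmax : ‖(γ 1 0, γ 0 0, γ 1 1)‖ ≤ ‖![γ 1 0, -γ 0 0]‖ * ‖![γ 1 0, γ 1 1]‖ :=
    max_le (hc'.trans (le_mul_of_one_le_right (norm_nonneg _) hone'))
      (max_le (((norm_neg (γ 0 0)).symm.le.trans ha).trans
        (le_mul_of_one_le_right (norm_nonneg _) hone'))
        (hd.trans (le_mul_of_one_le_left (norm_nonneg _) hone)))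
  calc _ ≤ r w * r z * (‖![γ 1 0, -γ 0 0]‖ * ‖![γ 1 0, γ 1 1]‖) :=
        mul_le_mul_of_nonneg_left hmax (mul_pos (r_pos w) (r_pos z)).le
    _ = r w * ‖![γ 1 0, -γ 0 0]‖ * (r z * ‖![γ 1 0, γ 1 1]‖) := by ring
    _ ≤ _ := r_mul_norm_mul_r_mul_norm_le_norm_cellProduct hc z w

lemma tendsto_norm_cofinite_of_injective {ι E : Type*} [NormedAddCommGroup E] [ProperSpace E]
    [DiscreteTopology E] {e : ι → E} (he : Function.Injective e) :
    Tendsto (fun i => ‖e i‖) cofinite atTop := by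
  have h := tendsto_norm_cocompact_atTop (E := E)
  rw [cocompact_eq_cofinite] at h
  exact h.comp he.tendsto_cofinite

lemma tendsto_norm_cellProduct (N : ℕ) (z w : ℍ) :
    Tendsto (fun γ : bigCell N => ‖cellProduct γ z w‖) cofinite atTop := by
  have hinj : Function.Injective fun γ : bigCell N => (γ.1 1 0, γ.1 0 0, γ.1 1 1) := by
    rintro γ δ h
    simp only [Prod.mk.injEq] at h
    exact Subtype.ext (eq_of_apply_eq_of_apply_one_zero_ne_zero γ.2.2 h.1 h.2.1 h.2.2)
  exact tendsto_atTop_mono (fun γ => r_mul_norm_le_norm_cellProduct γ.2.2 z w)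
    ((tendsto_norm_cofinite_of_injective hinj).const_mul_atTop (mul_pos (r_pos w) (r_pos z)))

lemma norm_inv_cellProduct_le (hc : γ 1 0 ≠ 0) (z w : ℍ) :
    ‖(cellProduct γ z w)⁻¹‖ ≤ (r w * r z)⁻¹ * ((γ 1 0).natAbs : ℝ) ^ (-2 : ℝ) := by
  have hpos : (0 : ℝ) < (γ 1 0).natAbs := Nat.cast_pos.2 (Int.natAbs_pos.2 hc)
  rw [Real.rpow_neg hpos.le, Real.rpow_two, ← mul_inv, norm_inv]
  exact inv_anti₀ (mul_pos (mul_pos (r_pos w) (r_pos z)) (by positivity))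
    (r_mul_sq_le_norm_cellProduct hc z w)

lemma cellWeight_mul_rpow (hc : γ 1 0 ≠ 0) (σ ρ τ : ℝ) :
    cellWeight σ ρ γ * ((γ 1 0).natAbs : ℝ) ^ (-τ) = cellWeight σ (ρ + τ) γ := by
  rw [cellWeight, cellWeight, neg_add,
    Real.rpow_add (Nat.cast_pos.2 (Int.natAbs_pos.2 hc)), mul_right_comm]

lemma exists_norm_cauchyTerm_sub_leadTerm_le {K : Set ℂ} (hK : IsCompact K) (z w : ℍ)
    {σ : ℝ} (hσ : 0 ≤ σ) (hσK : ∀ s ∈ K, σ ≤ 4 * s.re - 2) :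
    ∃ C, ∀ s ∈ K, ∀ γ : SL(2, ℤ), γ 1 0 ≠ 0 → 2 ≤ ‖cellProduct γ z w‖ →
      ‖cauchyTerm γ z w s - leadTerm γ z w s‖ ≤ C * cellWeight σ (σ + 2) γ := by
  obtain ⟨B, hB⟩ := exists_norm_heckeFactor_mul_sub_one_le hK
  obtain ⟨A, hA⟩ := (holomorphicDecayingC2_leadA w.im_pos hσ hσK).exists_decayingC2 K
    subset_rfl hK
  obtain ⟨D, hD⟩ := (holomorphicDecayingC2_leadD z.im_pos hσ hσK).exists_decayingC2 K
    subset_rfl hK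
  refine ⟨A * D * (B * (r w * r z)⁻¹), fun s hs γ hc hm => ?_⟩
  have hm' := (norm_cellProduct_conj γ z w).symm ▸ hm
  have hhalf {ζ : ℂ} (hζ : 2 ≤ ‖ζ‖) : ‖ζ⁻¹‖ ≤ 1 / 2 := by
    rw [norm_inv, one_div]
    exact inv_anti₀ two_pos hζ
  have hne {ζ : ℂ} (hζ : 2 ≤ ‖ζ‖) : ζ ≠ 0 := norm_pos_iff.1 (two_pos.trans_le hζ)
  have hratio := hB s hs _ _ (hhalf hm) (hhalf hm')
  rw [norm_inv (cellProduct γ z (conj (w : ℂ))), norm_cellProduct_conj, ← norm_inv, max_self]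
    at hratio
  rw [cauchyTerm_eq_leadTerm_mul z.im_ne_zero w.im_ne_zero hc (hne hm) (hne hm'), ← mul_sub_one,
    norm_mul]
  have hlead := norm_leadTerm_le (hA s hs) (hD s hs) (hσK s hs) hc
  calc _ ≤ A * D * cellWeight σ σ γ * (B * ((r w * r z)⁻¹ *
        ((γ 1 0).natAbs : ℝ) ^ (-2 : ℝ))) :=
        mul_le_mul hlead (hratio.trans (mul_le_mul_of_nonneg_left (norm_inv_cellProduct_le hc z w)
          B.2)) (norm_nonneg _) ((norm_nonneg _).trans hlead)
    _ = _ := by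
        rw [← cellWeight_mul_rpow hc]
        ring

lemma differentiable_cauchyTerm {z w : ℂ} (hw : mu γ z (-w) ≠ 0) (hw' : mu γ z (-conj w) ≠ 0) :
    Differentiable ℂ fun s => cauchyTerm γ z w s := by
  simp only [cauchyTerm_eq_heckeFactor_mul]
  exact (differentiable_heckeFactor hw).mul (differentiable_heckeFactor hw')

lemma differentiable_leadTerm (hc : γ 1 0 ≠ 0) {z w : ℂ} (hz : z.im ≠ 0) (hw : w.im ≠ 0) :
    Differentiable ℂ fun s => leadTerm γ z w s :=
  (differentiable_natCast_cpow (Int.natAbs_ne_zero.2 hc)).mul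
    ((differentiable_cpowPair (by simpa using hw) (by fun_prop) (by fun_prop) _).mul
      (differentiable_cpowPair hz (by fun_prop) (by fun_prop) _))

lemma hasContinuation_cauchyTerm_sub_leadTerm
    (hdiff : ∀ γ : bigCell N, Differentiable ℂ fun s => cauchyTerm γ z w s) :
    HasContinuation {s | 47 / 48 < s.re} fun (γ : bigCell N) s =>
      cauchyTerm γ z w s - leadTerm γ z w s := by
  have hU : IsOpen {s : ℂ | 47 / 48 < s.re} := Complex.isOpen_re_gt _
  refine hasContinuation_of_summableLocallyUniformlyOn hU
    (fun s (hs : 1 < s.re) => show 47 / 48 < s.re by linarith)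
    (.of_locally_bounded_eventually hU fun K hKU hK => ?_) fun γ =>
      ((hdiff γ).sub (differentiable_leadTerm γ.2.2 z.im_ne_zero w.im_ne_zero)).differentiableOn
  have hre (s : ℂ) (hs : s ∈ K) : 3 / 2 ≤ 4 * s.re - 2 := by
    linarith [show 47 / 48 < s.re from hKU hs]
  obtain ⟨C, hC⟩ := exists_norm_cauchyTerm_sub_leadTerm_le hK z w (by norm_num) hre
  refine ⟨_, (summable_cellWeight (r := 3 / 2) (ρ := 3 / 2 + 2) (by norm_num)
    (by norm_num)).mul_left C, ?_⟩
  filter_upwards [(tendsto_norm_cellProduct N z w).eventually_ge_atTop 2] with γ hγ s hs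
  exact hC s hs γ γ.2.2 hγ

end BigCellRemainder

/-! ### Upper triangular matrices -/

section UpperTriangular

open Filter

/-- The matrices with lower left entry zero, which belong to every `Γ₀(N)`. -/
def upperTriangular : Set SL(2, ℤ) := {γ | γ 1 0 = 0}

variable {γ : SL(2, ℤ)} {z w ζ s : ℂ} {r : ℝ}

lemma apply_zero_zero_mul_apply_one_one (hc : γ 1 0 = 0) : γ 0 0 * γ 1 1 = 1 := by
  simpa [hc] using apply_mul_apply_sub_eq_one γ

/-- The parametrization of the upper triangular matrices by their upper row. -/
def upperRow (γ : upperTriangular) : ℤˣ × ℤ :=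
  (Units.mkOfMulEqOne _ _ (apply_zero_zero_mul_apply_one_one γ.2), γ.1 0 1)

lemma upperRow_injective : Function.Injective upperRow := by
  intro γ δ h
  obtain ⟨hunit, h01⟩ := Prod.mk.inj h
  have h00 : γ.1 0 0 = δ.1 0 0 := congrArg Units.val hunit
  have h11 : γ.1 1 1 = δ.1 1 1 := congrArg (fun u : ℤˣ => ((u⁻¹ : ℤˣ) : ℤ)) hunit
  have h10 : γ.1 1 0 = δ.1 1 0 := γ.2.trans δ.2.symm
  ext i j
  fin_cases i <;> fin_cases j <;> assumption

lemma summable_decay_upperTriangular (hr : 1 < r) :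
    Summable fun γ : upperTriangular => decay r (γ.1 0 1) := by
  have hprod : Summable fun x : ℤˣ × ℤ => decay r x.2 :=
    (hasSum_prod_of_fintype fun _ : ℤˣ => (summable_decay_int hr).hasSum).summable
  have hrow : Summable fun γ : upperTriangular => decay r (upperRow γ).2 :=
    hprod.comp_injective upperRow_injective
  exact hrow

lemma abs_lt_abs_of_decay_lt (hr : 0 ≤ r) {x y : ℝ} (h : decay r x < decay r y) : |y| < |x| := by
  by_contra! hxy
  exact h.not_ge (Real.rpow_le_rpow_of_nonpos (by positivity) (by linarith) (by linarith))

lemma eventually_le_abs_upperTriangular (T : ℝ) :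
    ∀ᶠ γ : upperTriangular in cofinite, T ≤ |(γ.1 0 1 : ℝ)| := by
  filter_upwards [(summable_decay_upperTriangular
    one_lt_two).tendsto_cofinite_zero.eventually_lt_const (decay_pos 2 T)] with γ hγ
  exact (le_abs_self T).trans (abs_lt_abs_of_decay_lt zero_le_two hγ).le

lemma norm_intCast_of_mul_eq_one {a d : ℤ} (h : a * d = 1) : ‖(a : ℂ)‖ = 1 := by
  rcases Int.eq_one_or_neg_one_of_mul_eq_one h with rfl | rfl <;> simp

lemma abs_apply_zero_one_le (hc : γ 1 0 = 0) (z v : ℂ) :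
    |(γ 0 1 : ℝ)| ≤ ‖mu γ z (-v)‖ + (‖z‖ + ‖v‖) := by
  have had := apply_zero_zero_mul_apply_one_one hc
  have hb : (γ 0 1 : ℂ) = mu γ z (-v) - (γ 0 0 * z - γ 1 1 * v) := by
    rw [mu, hc]
    push_cast
    ring
  calc |(γ 0 1 : ℝ)| = ‖mu γ z (-v) - (γ 0 0 * z - γ 1 1 * v)‖ := by
        rw [← hb, Complex.norm_intCast]
    _ ≤ ‖mu γ z (-v)‖ + (‖(γ 0 0 : ℂ) * z‖ + ‖(γ 1 1 : ℂ) * v‖) :=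
        (norm_sub_le _ _).trans (by gcongr; exact norm_sub_le _ _)
    _ = _ := by
        rw [norm_mul, norm_mul, norm_intCast_of_mul_eq_one had,
          norm_intCast_of_mul_eq_one ((mul_comm _ _).trans had), one_mul, one_mul]

lemma norm_heckeFactor_le_rpow {t : ℝ} (ht : 1 ≤ t) (htζ : t ≤ ‖ζ‖) (hr : 0 ≤ r)
    (hs : r ≤ 2 * s.re - 1) : ‖heckeFactor s ζ‖ ≤ t ^ (-r) := by
  have hone : 1 ≤ ‖ζ‖ := ht.trans htζ
  rw [norm_heckeFactor (norm_pos_iff.1 (one_pos.trans_le hone))]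
  calc ‖ζ‖ ^ (1 - 2 * s.re) ≤ ‖ζ‖ ^ (-r) :=
        Real.rpow_le_rpow_of_exponent_le hone (by linarith)
    _ ≤ t ^ (-r) := Real.rpow_le_rpow_of_nonpos (by linarith) htζ (by linarith)

lemma norm_cauchyTerm_le_decay (hc : γ 1 0 = 0) (hb : 2 * (‖z‖ + ‖w‖) + 1 ≤ |(γ 0 1 : ℝ)|)
    (hr : 0 ≤ r) (hs : r ≤ 4 * s.re - 2) :
    ‖cauchyTerm γ z w s‖ ≤ 2 ^ r * decay r (γ 0 1) := by
  have hnonneg : 0 ≤ ‖z‖ + ‖w‖ := by positivity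
  have hfactor {v : ℂ} (hv : ‖v‖ = ‖w‖) :
      ‖heckeFactor s (mu γ z (-v))‖ ≤ ((1 + |(γ 0 1 : ℝ)|) / 2) ^ (-(r / 2)) := by
    have := hv ▸ abs_apply_zero_one_le hc z v
    exact norm_heckeFactor_le_rpow (by linarith) (by linarith) (by linarith) (by linarith)
  calc ‖cauchyTerm γ z w s‖
      ≤ ((1 + |(γ 0 1 : ℝ)|) / 2) ^ (-(r / 2)) * ((1 + |(γ 0 1 : ℝ)|) / 2) ^ (-(r / 2)) := by
        rw [cauchyTerm_eq_heckeFactor_mul, norm_mul]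
        gcongr
        exacts [hfactor rfl, hfactor (Complex.norm_conj w)]
    _ = 2 ^ r * decay r (γ 0 1) := by
        rw [← Real.rpow_add (by positivity), ← neg_add, add_halves,
          Real.div_rpow (by positivity) zero_le_two, Real.rpow_neg zero_le_two, div_inv_eq_mul,
          mul_comm, decay]

lemma hasContinuation_cauchyTerm_upperTriangular
    (hdiff : ∀ γ : upperTriangular, Differentiable ℂ fun s => cauchyTerm γ z w s) :
    HasContinuation {s | 47 / 48 < s.re} fun (γ : upperTriangular) s => cauchyTerm γ z w s := by
  have hU : IsOpen {s : ℂ | 47 / 48 < s.re} := Complex.isOpen_re_gt _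
  refine hasContinuation_of_summableLocallyUniformlyOn hU
    (fun s (hs : 1 < s.re) => show 47 / 48 < s.re by linarith)
    (.of_locally_bounded_eventually hU fun K hKU _ => ?_) fun γ => (hdiff γ).differentiableOn
  refine ⟨_, (summable_decay_upperTriangular (r := 3 / 2) (by norm_num)).mul_left (2 ^ (3 / 2 : ℝ)),
    ?_⟩
  filter_upwards [eventually_le_abs_upperTriangular (2 * (‖z‖ + ‖w‖) + 1)] with γ hγ s hs
  exact norm_cauchyTerm_le_decay γ.2 hγ (by norm_num)
    (by linarith [show 47 / 48 < s.re from hKU hs])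

end UpperTriangular

/-! ### Summation over the group -/

section Gamma0

variable {N : ℕ} {z w : ℍ} {γ : SL(2, ℤ)}

lemma coe_gamma0_eq_bigCell_union_upperTriangular (N : ℕ) :
    (CongruenceSubgroup.Gamma0 N : Set SL(2, ℤ)) = bigCell N ∪ upperTriangular := by
  ext γ
  have hsub : γ 1 0 = 0 → γ ∈ CongruenceSubgroup.Gamma0 N := fun h => by
    simp [CongruenceSubgroup.Gamma0_mem, h]
  simp only [bigCell, upperTriangular, SetLike.mem_coe, Set.mem_union, Set.mem_ofPred_eq]
  tauto

lemma disjoint_bigCell_upperTriangular (N : ℕ) : Disjoint (bigCell N) upperTriangular :=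
  Set.disjoint_left.2 fun _ h => h.2

lemma coe_smul_eq_of_mu_neg_eq_zero {v : ℂ} (h : mu γ z (-v) = 0) : ((γ • z : ℍ) : ℂ) = v := by
  have hdenom := UpperHalfPlane.denom_ne_zero γ z
  rw [ModularGroup.denom_apply] at hdenom
  rw [UpperHalfPlane.coe_specialLinearGroup_apply, div_eq_iff (by simpa using hdenom)]
  rw [mu] at h
  push_cast [algebraMap_int_eq, eq_intCast]
  linear_combination h

lemma mu_neg_ne_zero (hγ : γ • z ≠ w) : mu γ z (-w) ≠ 0 :=
  fun h => hγ (UpperHalfPlane.ext (coe_smul_eq_of_mu_neg_eq_zero h))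

lemma mu_neg_conj_ne_zero (γ : SL(2, ℤ)) (z w : ℍ) : mu γ z (-conj (w : ℂ)) ≠ 0 := by
  intro h
  have him := congrArg Complex.im (coe_smul_eq_of_mu_neg_eq_zero h)
  rw [Complex.conj_im] at him
  linarith [(γ • z).im_pos, w.im_pos, show ((γ • z : ℍ) : ℂ).im = (γ • z).im from rfl,
    show (w : ℂ).im = w.im from rfl]

lemma hasContinuation_cauchyTerm (hN : N ≠ 0)
    (hzw : ∀ γ ∈ CongruenceSubgroup.Gamma0 N, γ • z ≠ w) :
    HasContinuation {s | 47 / 48 < s.re} fun (γ : CongruenceSubgroup.Gamma0 N) s =>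
      cauchyTerm γ z w s := by
  have hdiff (γ : SL(2, ℤ)) (hγ : γ ∈ (CongruenceSubgroup.Gamma0 N : Set SL(2, ℤ))) :
      Differentiable ℂ fun s => cauchyTerm γ z w s :=
    differentiable_cauchyTerm (mu_neg_ne_zero (hzw γ hγ)) (mu_neg_conj_ne_zero γ z w)
  have hcell := coe_gamma0_eq_bigCell_union_upperTriangular N
  rw [hcell] at hdiff
  have hbig : HasContinuation {s | 47 / 48 < s.re} fun (γ : bigCell N) s => cauchyTerm γ z w s := by
    simpa only [sub_add_cancel] using (hasContinuation_cauchyTerm_sub_leadTerm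
      fun γ => hdiff γ (.inl γ.2)).add (hasContinuation_leadTerm hN z.im_pos w.im_pos)
  have hsmall := hasContinuation_cauchyTerm_upperTriangular (z := z) (w := w)
    fun γ => hdiff γ (.inr γ.2)
  have hunion := HasContinuation.union (f := fun γ s => cauchyTerm γ z w s)
    (disjoint_bigCell_upperTriangular N) hbig hsmall
  rw [← hcell] at hunion
  exact hunion

end Gamma0

theorem mainTheorem4 (N : ℕ) (hN : 1 ≤ N) (z₁ z₂ : ℍ)
    (hz : ∀ γ ∈ CongruenceSubgroup.Gamma0 N, γ • z₁ ≠ z₂) :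
    (∀ s : ℂ, 1 < s.re →
      Summable fun γ : CongruenceSubgroup.Gamma0 N =>
        cauchyTerm (γ : SL(2, ℤ)) (z₁ : ℂ) (z₂ : ℂ) s) ∧
    ∃ (U : Set ℂ) (F : ℂ → ℂ),
      IsOpen U ∧ IsConnected U ∧ {s : ℂ | 1 < s.re} ⊆ U ∧ (1 : ℂ) ∈ U ∧
      AnalyticOnNhd ℂ F U ∧
      ∀ s : ℂ, 1 < s.re → F s = cauchyKernel N (z₁ : ℂ) (z₂ : ℂ) s := by
  obtain ⟨F, hF, hsum⟩ := hasContinuation_cauchyTerm (Nat.one_le_iff_ne_zero.1 hN) hz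
  have hU : IsOpen {s : ℂ | 47 / 48 < s.re} := Complex.isOpen_re_gt _
  have hone : (1 : ℂ) ∈ {s : ℂ | 47 / 48 < s.re} := by norm_num
  refine ⟨fun s hs => (hsum s hs).summable, {s | 47 / 48 < s.re}, fun s => 1 / 2 * F s, hU,
    ⟨⟨1, hone⟩, (convex_halfSpace_re_gt _).isPreconnected⟩,
    fun s (hs : 1 < s.re) => show 47 / 48 < s.re by linarith, hone,
    (hF.const_mul (1 / 2)).analyticOnNhd hU, fun s hs => ?_⟩
  rw [cauchyKernel, (hsum s hs).tsum_eq]
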